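/- Let $K$ be an $F$-finite field of prime characteristic $p$ (that is, $K$ is a finite extension of $K^p$), let $S=K[x_1,\ldots,x_n]$ with the standard grading and $\mathfrak m=(x_1,\ldots,x_n)$, let $I\subseteq S$ be a squarefree monomial ideal, and let $R=S/I$. For a graded quotient $B$ of $S$ let $a_i(B)=\max\{s\in\mathbb Z \mid H^i_{\mathfrak m}(B)_s\neq 0\}$, with $a_i(B)=-\infty$ if $H^i_{\mathfrak m}(B)=0$, and $\operatorname{reg}(B)=\max_i\{a_i(B)+i\}$. Let $J\subsetneq R$ be a proper homogeneous ideal, whose inverse image in $S$ is also denoted by $J$, and let $J^{[p^e]}$ be the ideal of $R$ generated by the $p^e$-th powers of the elements of $J$. Put $\mathcal A'=\{0,1\}^n$, $J_\alpha=(I:x^\alpha)$ and $|\alpha|=\alpha_1+\cdots+\alpha_n$ for $\alpha\in\mathcal A'$, and $d=\max\{\dim (S/(J_\alpha+J)) \mid \alpha\in\mathcal A'\}$. Then $\operatorname{reg}(R/J^{[p^e]})$ is an integer for every $e \geq 0$, and $$\lim_{e\to\infty}\frac{\operatorname{reg}(R/J^{[p^e]})}{p^e}=\max_{\substack{0\le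 i\le d\\ \alpha\in\mathcal A'}}\{a_i(S/(J_\alpha+J))+|\alpha|\}.$$ In particular, this limit exists and is an integer. -/

import Mathlib

open MvPolynomial Filter Topology

noncomputable section

namespace SRRegularity

/-! ### The Čech complex of a module with respect to finitely many elements -/

section Cech

variable {A : Type*} [CommRing A] {n : ℕ} (x : Fin n → A) (M : Type*) [AddCommGroup M] [Module A M]

/-- The product `x_σ = ∏ j ∈ σ, x j`. -/
def xProd (σ : Finset (Fin n)) : A := ∏ j ∈ σ, x j

theorem xProd_dvd {τ σ : Finset (Fin n)} (h : τ ⊆ σ) : xProd x τ ∣ xProd x σ :=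
  Finset.prod_dvd_prod_of_subset τ σ x h

/-- The localization `M_{x_σ}` of `M` at the powers of `x_σ`. -/
abbrev Loc (σ : Finset (Fin n)) : Type _ := LocalizedModule (Submonoid.powers (xProd x σ)) M

theorem isUnit_of_dvd {f g : A} (h : f ∣ g) (u : Submonoid.powers f) :
    IsUnit (algebraMap A (Module.End A (LocalizedModule (Submonoid.powers g) M)) u) := by
  obtain ⟨c, rfl⟩ := h
  obtain ⟨_, k, rfl⟩ := u
  have h1 : IsUnit (algebraMap A (Module.End A (LocalizedModule (Submonoid.powers (f * c)) M))
      (f * c)) :=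
    IsLocalizedModule.map_units (LocalizedModule.mkLinearMap (Submonoid.powers (f * c)) M)
      ⟨f * c, Submonoid.mem_powers _⟩
  rw [map_mul] at h1
  have hc : Commute (algebraMap A (Module.End A (LocalizedModule (Submonoid.powers (f * c)) M)) f)
      (algebraMap A _ c) := Algebra.commutes f _
  have h2 := (hc.isUnit_mul_iff.mp h1).1
  simpa only [map_pow] using h2.pow k

/-- For `τ ⊆ σ`, the canonical map `M_{x_τ} → M_{x_σ}`, `m / x_τ ^ k ↦ m / x_τ ^ k`. -/
def res {τ σ : Finset (Fin n)} (h : τ ⊆ σ) : Loc x M τ →ₗ[A] Loc x M σ :=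
  LocalizedModule.lift _ (LocalizedModule.mkLinearMap _ M)
    (isUnit_of_dvd M (xProd_dvd x h))

/-- The module `C^i = ⨁_{|σ| = i} M_{x_σ}` of Čech cochains. -/
abbrev Cochain (i : ℕ) : Type _ := (σ : {σ : Finset (Fin n) // σ.card = i}) → Loc x M σ.1

/-- The Čech differential `C^i → C^{i+1}`,
`(d c)_σ = ∑ j ∈ σ, (-1)^{#{k ∈ σ | k < j}} c_{σ ∖ {j}}`. -/
def cechD (i : ℕ) : Cochain x M i →ₗ[A] Cochain x M (i + 1) :=
  LinearMap.pi fun σ => ∑ j : {j // j ∈ σ.1},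
    ((-1 : A) ^ (σ.1.filter (· < j.1)).card) •
      (res x M (Finset.erase_subset j.1 σ.1)).comp
        (LinearMap.proj (φ := fun σ : {σ : Finset (Fin n) // σ.card = i} => Loc x M σ.1)
          ⟨σ.1.erase j.1, by rw [Finset.card_erase_of_mem j.2, σ.2]; rfl⟩)

/-- The coboundaries in `C^i`: the image of `C^{i-1} → C^i`, which is zero for `i = 0`. -/
def cechB : (i : ℕ) → Submodule A (Cochain x M i)
  | 0 => ⊥
  | i + 1 => LinearMap.range (cechD x M i)

/-- The `i`-th Čech cohomology module of `M` with respect to `x`. Over a Noetherian ring it is the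
local cohomology module `H^i_𝔪(M)` with support in the ideal `𝔪` generated by the `x j`. -/
abbrev LocalCoh (i : ℕ) : Type _ :=
  LinearMap.ker (cechD x M i) ⧸ (cechB x M i).submoduleOf (LinearMap.ker (cechD x M i))

variable {M} (𝓜 : ℤ → AddSubgroup M)

/-- The degree `s` part of `M_{x_σ}`, when `M` is graded by `𝓜` and every `x j` has degree one: it
consists of the fractions `m / x_σ ^ k` with `m` homogeneous of degree `s + k * |σ|`. -/
def locDeg (σ : Finset (Fin n)) (s : ℤ) : AddSubgroup (Loc x M σ) :=
  AddSubgroup.closure {z | ∃ (k : ℕ) (m : M), m ∈ 𝓜 (s + k * σ.card) ∧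
    z = LocalizedModule.mk m (⟨xProd x σ ^ k, Submonoid.pow_mem _ (Submonoid.mem_powers _) k⟩ :
      Submonoid.powers (xProd x σ))}

/-- The degree `s` part of the module of Čech cochains. -/
def cochainDeg (i : ℕ) (s : ℤ) : AddSubgroup (Cochain x M i) :=
  AddSubgroup.pi Set.univ fun σ => locDeg x 𝓜 σ.1 s

/-- The degree `s` part `H^i_𝔪(M)_s`: the classes of the cocycles that are homogeneous of
degree `s`. -/
def localCohDeg (i : ℕ) (s : ℤ) : AddSubgroup (LocalCoh x M i) :=
  ((cochainDeg x 𝓜 i s).comap (LinearMap.ker (cechD x M i)).subtype.toAddMonoidHom).map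
    ((cechB x M i).submoduleOf (LinearMap.ker (cechD x M i))).mkQ.toAddMonoidHom

end Cech

/-! ### `a`-invariants and regularity of graded quotients of a polynomial ring -/

section Invariants

variable {K : Type*} [Field K] {n : ℕ}

/-- The degree `t` part of a quotient `B` of the standard graded polynomial ring
`S = K[x_1, …, x_n]` by a homogeneous ideal: the image of the forms of degree `t`
(zero if `t < 0`). -/
def degPart (K : Type*) [Field K] (n : ℕ) (B : Type*) [CommRing B] [Algebra (MvPolynomial (Fin n) K) B]
    (t : ℤ) : AddSubgroup B :=
  (weightedHomogeneousSubmodule K (fun _ : Fin n => (1 : ℤ)) t).toAddSubgroup.map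
    (algebraMap (MvPolynomial (Fin n) K) B).toAddMonoidHom

/-- The `i`-th `a`-invariant `a_i(B) = max {s | H^i_𝔪(B)_s ≠ 0}`, `𝔪 = (x_1, …, x_n)`, of a quotient
`B` of `K[x_1, …, x_n]` by a homogeneous ideal; it is `-∞` if `H^i_𝔪(B) = 0`. -/
def aInv (K : Type*) [Field K] (n : ℕ) (B : Type*) [CommRing B] [Algebra (MvPolynomial (Fin n) K) B]
    (i : ℕ) : EReal :=
  ⨆ (s : ℤ) (_ : localCohDeg (X : Fin n → MvPolynomial (Fin n) K) (degPart K n B) i s ≠ ⊥),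
    ((s : ℝ) : EReal)

/-- The Castelnuovo-Mumford regularity `reg(B) = max_i {a_i(B) + i}`. -/
def reg (K : Type*) [Field K] (n : ℕ) (B : Type*) [CommRing B] [Algebra (MvPolynomial (Fin n) K) B] :
    EReal :=
  ⨆ i : ℕ, aInv K n B i + ((i : ℝ) : EReal)

/-- A squarefree monomial ideal: an ideal generated by monomials `∏ j ∈ N, x_j` without
repeated variables. -/
def IsSquarefreeMonomial (I : Ideal (MvPolynomial (Fin n) K)) : Prop :=
  ∃ G : Set (Finset (Fin n)),
    I = Ideal.span ((fun N : Finset (Fin n) => ∏ j ∈ N, (X j : MvPolynomial (Fin n) K)) '' G)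

/-- The inverse image in `S` of an ideal `J` of `R = S / I`. -/
abbrev preimage {I : Ideal (MvPolynomial (Fin n) K)} (J : Ideal (MvPolynomial (Fin n) K ⧸ I)) :
    Ideal (MvPolynomial (Fin n) K) :=
  J.comap (Ideal.Quotient.mk I)

/-- An ideal `J` of `R = S / I`, with `I` homogeneous, is homogeneous iff its inverse image in `S`
is, i.e. iff that contains the homogeneous components of each of its elements. -/
def IsHomogeneousIdeal {I : Ideal (MvPolynomial (Fin n) K)}
    (J : Ideal (MvPolynomial (Fin n) K ⧸ I)) : Prop :=
  ∀ f ∈ preimage J, ∀ m : ℕ, homogeneousComponent m f ∈ preimage J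

/-- The ideal `J^{[q]}` generated by the `q`-th powers of the elements of `J`. -/
def bracketPow {R : Type*} [CommRing R] (J : Ideal R) (q : ℕ) : Ideal R :=
  Ideal.span ((fun f => f ^ q) '' (J : Set R))

/-- The quotient `S / ((I : x^α) + J)`, where `J` also stands for its inverse image in `S`. -/
abbrev ColonQuot {I : Ideal (MvPolynomial (Fin n) K)} (J : Ideal (MvPolynomial (Fin n) K ⧸ I))
    (α : Fin n →₀ ℕ) : Type _ :=
  MvPolynomial (Fin n) K ⧸ (I.colon {monomial α (1 : K)} ⊔ preimage J)

/-- The exponent vectors in `{0, 1}^n`. -/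
def zeroOneVectors (n : ℕ) : Set (Fin n →₀ ℕ) := {α | ∀ j, α j ≤ 1}

/-- `d = max {dim S / ((I : x^α) + J) | α ∈ {0, 1}^n}`, with Krull dimensions. -/
def maxDim {I : Ideal (MvPolynomial (Fin n) K)} (J : Ideal (MvPolynomial (Fin n) K ⧸ I)) :
    WithBot ℕ∞ :=
  ⨆ α ∈ zeroOneVectors n, ringKrullDim (ColonQuot J α)

end Invariants

end SRRegularity

end

/-! Write q = p^e. As K is finite over K^q, the ring S is free over its subring of q-th powers on
the elements b_l x^α, where b_l runs through a basis of K over K^q and 0 ≤ α_j < q. Since I is a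
squarefree monomial ideal, this splitting descends to quotients: R/J^[q], made an S-module through
the q-th power map, is the direct sum over (l, α) of copies of S/(J_α + J), with degree t of a
summand placed in degree qt + |α|. Localizing at x_σ or at x_σ^q is the same, so Čech cohomology
splits too. Hence H^i(R/J^[q])_s ≠ 0 iff s = qt + |α| for some α with entries below q and some t
with H^i(S/(J_α + J))_t ≠ 0 (`localCohDeg_ne_bot_iff_of_decomposition`,
`localCohDeg_bracketPow_ne_bot_iff`).

J_α depends only on the support β ∈ {0,1}^n of α (`IsSquarefreeMonomial.colon_congr`), and for q > 1
the largest |α| with support β is (q - 1)|β|. So the regularity is the maximum of q(t + |β|) - |β| +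
i, which differs from q max(t + |β|) by at most n. Division by q gives the limit.

The maxima are integers because local cohomology of graded quotients vanishes in high degrees
(`exists_degExact`) but not altogether (`exists_localCohDeg_ne_bot`). The range i ≤ d loses nothing
by Grothendieck vanishing (`degExact_of_ringKrullDim_lt`). The two vanishing results use Noetherian
induction on homogeneous ideals, comparing 𝔞 with 𝔞 + (x_j) and (𝔞 : x_j); nonvanishing uses
Noetherian induction on arbitrary ideals and prime avoidance. -/

noncomputable section

namespace SRRegularity

/-! ### Fractions, maps semilinear over powers, and the Čech differential -/

section Fractions

variable {A : Type*} [CommRing A] {n : ℕ} (x : Fin n → A) {M N : Type*}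
  [AddCommGroup M] [Module A M] [AddCommGroup N] [Module A N]

/-- The fraction `m / x_σ ^ k`. -/
def frac (σ : Finset (Fin n)) (m : M) (k : ℕ) : Loc x M σ :=
  LocalizedModule.mk m ⟨xProd x σ ^ k, Submonoid.pow_mem _ (Submonoid.mem_powers _) k⟩

theorem exists_frac {σ : Finset (Fin n)} (z : Loc x M σ) : ∃ m k, z = frac x σ m k := by
  induction z using LocalizedModule.induction_on with
  | _ m s =>
    obtain ⟨_, k, rfl⟩ := s
    exact ⟨m, k, rfl⟩

theorem frac_eq_frac {σ : Finset (Fin n)} {m m' : M} {k l : ℕ} :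
    frac x σ m k = frac x σ m' l ↔
      ∃ c, xProd x σ ^ (c + l) • m = xProd x σ ^ (c + k) • m' := by
  unfold frac
  rw [LocalizedModule.mk_eq]
  constructor
  · rintro ⟨⟨_, c, rfl⟩, h⟩
    refine ⟨c, ?_⟩
    simpa [Submonoid.smul_def, pow_add, mul_smul] using h
  · rintro ⟨c, h⟩
    refine ⟨⟨_, c, rfl⟩, ?_⟩
    simpa [Submonoid.smul_def, pow_add, mul_smul] using h

theorem frac_expand {σ : Finset (Fin n)} (m : M) (k l : ℕ) :
    frac x σ m k = frac x σ (xProd x σ ^ l • m) (k + l) := by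
  rw [frac_eq_frac]
  exact ⟨0, by rw [smul_smul, ← pow_add]; ring_nf⟩

theorem frac_zero (σ : Finset (Fin n)) (k : ℕ) : frac x σ (0 : M) k = 0 :=
  LocalizedModule.zero_mk _

theorem frac_add (σ : Finset (Fin n)) (m m' : M) (k : ℕ) :
    frac x σ (m + m') k = frac x σ m k + frac x σ m' k := by
  conv_rhs => unfold frac
  rw [LocalizedModule.mk_add_mk]
  simp only [frac]
  rw [LocalizedModule.mk_eq]
  refine ⟨1, ?_⟩
  simp [Submonoid.smul_def, smul_smul]

/-- The map `m ↦ m / x_σ ^ k`. -/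
def fracHom (σ : Finset (Fin n)) (k : ℕ) : M →+ Loc x M σ where
  toFun m := frac x σ m k
  map_zero' := frac_zero x σ k
  map_add' m m' := frac_add x σ m m' k

theorem frac_neg (σ : Finset (Fin n)) (m : M) (k : ℕ) :
    frac x σ (-m) k = -frac x σ m k :=
  map_neg (fracHom x σ k) m

theorem frac_sum {ι : Type*} (σ : Finset (Fin n)) (s : Finset ι) (f : ι → M) (k : ℕ) :
    frac x σ (∑ i ∈ s, f i) k = ∑ i ∈ s, frac x σ (f i) k :=
  map_sum (fracHom x σ k) f s

theorem smul_frac (σ : Finset (Fin n)) (a : A) (m : M) (k : ℕ) :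
    a • frac x σ m k = frac x σ (a • m) k :=
  LocalizedModule.smul'_mk _ _ _

theorem frac_eq_zero {σ : Finset (Fin n)} {m : M} {k : ℕ} :
    frac x σ m k = 0 ↔ ∃ c, xProd x σ ^ c • m = 0 := by
  rw [← frac_zero x σ 0, frac_eq_frac]
  constructor
  · rintro ⟨c, h⟩
    exact ⟨c, by simpa using h⟩
  · rintro ⟨c, h⟩
    exact ⟨c, by simpa using h⟩

theorem exists_frac_pair {σ : Finset (Fin n)} (z w : Loc x M σ) :
    ∃ m m' k, z = frac x σ m k ∧ w = frac x σ m' k := by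
  obtain ⟨m, k, rfl⟩ := exists_frac x z
  obtain ⟨m', l, rfl⟩ := exists_frac x w
  exact ⟨_, _, k + l, frac_expand x m k l, by rw [add_comm k l]; exact frac_expand x m' l k⟩

/-- Powers of x_σ act invertibly on the localization, so identities may be checked after clearing
denominators. -/
theorem xProd_smul_injective {σ : Finset (Fin n)} (k : ℕ) {z w : Loc x M σ}
    (h : xProd x σ ^ k • z = xProd x σ ^ k • w) : z = w := by
  obtain ⟨m, m', l, rfl, rfl⟩ := exists_frac_pair x z w
  rw [smul_frac, smul_frac, frac_eq_frac] at h
  obtain ⟨c, h⟩ := h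
  rw [frac_eq_frac]
  refine ⟨c + k, ?_⟩
  simp only [smul_smul, ← pow_add] at h
  rwa [add_right_comm c k l]

theorem xProd_pow_smul_frac (σ : Finset (Fin n)) (m : M) (k : ℕ) :
    xProd x σ ^ k • frac x σ m k = frac x σ m 0 := by
  rw [smul_frac, frac_eq_frac]
  exact ⟨0, by simp⟩

theorem xProd_mul_sdiff {τ σ : Finset (Fin n)} (h : τ ⊆ σ) :
    xProd x σ = xProd x (σ \ τ) * xProd x τ :=
  (Finset.prod_sdiff h).symm

theorem res_frac {τ σ : Finset (Fin n)} (h : τ ⊆ σ) (m : M) (k : ℕ) :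
    res x M h (frac x τ m k) = frac x σ (xProd x (σ \ τ) ^ k • m) k := by
  apply xProd_smul_injective x k
  have e : xProd x σ ^ k • frac x τ m k = frac x τ (xProd x (σ \ τ) ^ k • m) 0 := by
    rw [xProd_mul_sdiff x h, mul_pow, mul_smul, xProd_pow_smul_frac, smul_frac]
  rw [xProd_pow_smul_frac, ← map_smul, e]
  have (m : M) : res x M h (frac x τ m 0) = frac x σ m 0 := by
    have h0 (σ : Finset (Fin n)) : frac x σ m 0 = LocalizedModule.mkLinearMap _ M m := by
      unfold frac
      rw [LocalizedModule.mkLinearMap_apply]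
      congr 1
      ext
      simp
    rw [h0, h0]
    exact LinearMap.congr_fun (LocalizedModule.lift_comp _ _ (isUnit_of_dvd M (xProd_dvd x h))) m
  rw [this]

theorem res_res {ρ τ σ : Finset (Fin n)} (h : ρ ⊆ τ) (h' : τ ⊆ σ) (z : Loc x M ρ) :
    res x M h' (res x M h z) = res x M (h.trans h') z := by
  obtain ⟨m, k, rfl⟩ := exists_frac x z
  rw [res_frac, res_frac, res_frac, smul_smul, ← mul_pow]
  congr 3
  unfold xProd
  rw [← Finset.prod_union]
  · congr 1
    ext a
    simp only [Finset.mem_union, Finset.mem_sdiff]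
    by_cases h1 : a ∈ τ
    · simp [h1, h' h1]
    · have : a ∉ ρ := fun h2 => h1 (h h2)
      simp [h1, this]
  · rw [Finset.disjoint_left]
    intro a ha hb
    simp only [Finset.mem_sdiff] at ha hb
    exact ha.2 hb.1

/-- The map `m / x_σ ^ k ↦ φ m / x_σ ^ (k q)` induced by an additive map `φ` that satisfies
`φ (a m) = a ^ q φ m`. -/
def locMap (q : ℕ) (φ : M →+ N) (hφ : ∀ (a : A) m, φ (a • m) = a ^ q • φ m)
    (σ : Finset (Fin n)) : Loc x M σ →+ Loc x N σ where
  toFun z := z.liftOn (fun p => LocalizedModule.mk (φ p.1) (p.2 ^ q)) (by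
    rintro ⟨m, s⟩ ⟨m', s'⟩ ⟨u, hu⟩
    dsimp only
    rw [LocalizedModule.mk_eq]
    refine ⟨u ^ q, ?_⟩
    have := congrArg φ hu
    simpa only [Submonoid.smul_def, hφ, SubmonoidClass.coe_pow] using this)
  map_zero' := by
    rw [← LocalizedModule.zero_mk 1, LocalizedModule.liftOn_mk, map_zero]
    simp
  map_add' z w := by
    induction z using LocalizedModule.induction_on with
    | _ m s =>
    induction w using LocalizedModule.induction_on with
    | _ m' s' =>
    rw [LocalizedModule.mk_add_mk, LocalizedModule.liftOn_mk, LocalizedModule.liftOn_mk,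
      LocalizedModule.liftOn_mk, LocalizedModule.mk_add_mk, mul_pow]
    congr 1
    simp only [Submonoid.smul_def, hφ, map_add, SubmonoidClass.coe_pow]

theorem locMap_frac (q : ℕ) (φ : M →+ N) (hφ : ∀ (a : A) m, φ (a • m) = a ^ q • φ m)
    (σ : Finset (Fin n)) (m : M) (k : ℕ) :
    locMap x q φ hφ σ (frac x σ m k) = frac x σ (φ m) (k * q) := by
  change LocalizedModule.mk _ _ = LocalizedModule.mk _ _
  congr 1
  ext
  simp [pow_mul]

theorem locMap_res (q : ℕ) (φ : M →+ N) (hφ : ∀ (a : A) m, φ (a • m) = a ^ q • φ m)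
    {τ σ : Finset (Fin n)} (h : τ ⊆ σ) (z : Loc x M τ) :
    locMap x q φ hφ σ (res x M h z) = res x N h (locMap x q φ hφ τ z) := by
  obtain ⟨m, k, rfl⟩ := exists_frac x z
  rw [res_frac, locMap_frac, locMap_frac, res_frac, hφ, pow_mul]

/-- The map `m / x_σ ^ k ↦ π (x_σ ^ (k (q - 1)) m) / x_σ ^ k` induced by an additive map `π` that
satisfies `π (a ^ q m) = a π m`. -/
def locDesc (q : ℕ) (hq : 0 < q) (π : M →+ N) (hπ : ∀ (a : A) m, π (a ^ q • m) = a • π m)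
    (σ : Finset (Fin n)) : Loc x M σ →+ Loc x N σ where
  toFun z := z.liftOn (fun p => LocalizedModule.mk (π (p.2 ^ (q - 1) • p.1)) p.2) (by
    obtain ⟨r, rfl⟩ : ∃ r, q = r + 1 := ⟨q - 1, by omega⟩
    rintro ⟨m, s⟩ ⟨m', s'⟩ ⟨u, hu⟩
    dsimp only
    rw [LocalizedModule.mk_eq]
    refine ⟨u, ?_⟩
    -- The extra factor completes every scalar to a q-th power times a common remainder, so that it
    -- can be pulled out of `π`.
    have := congrArg (fun y => π ((u ^ r * s ^ r * s' ^ r) • y)) hu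
    simp only [Submonoid.smul_def, SubmonoidClass.coe_pow, ← hπ, smul_smul, Submonoid.coe_mul]
      at this ⊢
    convert this using 3 <;> (simp; ring))
  map_zero' := by
    rw [← LocalizedModule.zero_mk 1, LocalizedModule.liftOn_mk, smul_zero, map_zero]
    simp
  map_add' z w := by
    obtain ⟨r, rfl⟩ : ∃ r, q = r + 1 := ⟨q - 1, by omega⟩
    induction z using LocalizedModule.induction_on with
    | _ m s =>
    induction w using LocalizedModule.induction_on with
    | _ m' s' =>
    rw [LocalizedModule.mk_add_mk, LocalizedModule.liftOn_mk, LocalizedModule.liftOn_mk,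
      LocalizedModule.liftOn_mk, LocalizedModule.mk_add_mk]
    congr 1
    simp only [Submonoid.smul_def, SubmonoidClass.coe_pow, ← hπ, smul_smul, Submonoid.coe_mul,
      smul_add, map_add, Nat.add_sub_cancel]
    congr 2 <;> (congr 1; ring)

theorem locDesc_frac (q : ℕ) (hq : 0 < q) (π : M →+ N)
    (hπ : ∀ (a : A) m, π (a ^ q • m) = a • π m) (σ : Finset (Fin n)) (m : M) (k : ℕ) :
    locDesc x q hq π hπ σ (frac x σ m k) =
      frac x σ (π (xProd x σ ^ (k * (q - 1)) • m)) k := by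
  change LocalizedModule.mk _ _ = LocalizedModule.mk _ _
  congr 1
  rw [pow_mul]
  rfl

theorem locDesc_res (q : ℕ) (hq : 0 < q) (π : M →+ N)
    (hπ : ∀ (a : A) m, π (a ^ q • m) = a • π m)
    {τ σ : Finset (Fin n)} (h : τ ⊆ σ) (z : Loc x M τ) :
    locDesc x q hq π hπ σ (res x M h z) = res x N h (locDesc x q hq π hπ τ z) := by
  obtain ⟨m, k, rfl⟩ := exists_frac x z
  obtain ⟨r, rfl⟩ : ∃ r, q = r + 1 := ⟨q - 1, by omega⟩
  rw [res_frac, locDesc_frac, locDesc_frac, res_frac, ← hπ, smul_smul, smul_smul,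
    xProd_mul_sdiff x h]
  refine congrArg (fun y => frac x σ (π (y • m)) k) ?_
  simp only [Nat.add_sub_cancel]
  ring

/-- The map of Čech cochains given by maps of the localizations. -/
def cochainMap (Ψ : ∀ σ, Loc x M σ →+ Loc x N σ) (i : ℕ) :
    Cochain x M i →+ Cochain x N i where
  toFun c σ := Ψ σ.1 (c σ)
  map_zero' := by ext; simp
  map_add' c c' := by ext; simp

@[simp] theorem cochainMap_apply (Ψ : ∀ σ, Loc x M σ →+ Loc x N σ) (i : ℕ) (c : Cochain x M i)
    (σ : {σ : Finset (Fin n) // σ.card = i}) : cochainMap x Ψ i c σ = Ψ σ.1 (c σ) := rfl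

theorem cechD_apply {i : ℕ} (c : Cochain x M i) (σ : {σ : Finset (Fin n) // σ.card = i + 1}) :
    cechD x M i c σ = ∑ j : {j // j ∈ σ.1}, ((-1 : A) ^ (σ.1.filter (· < j.1)).card) •
      res x M (Finset.erase_subset j.1 σ.1)
        (c ⟨σ.1.erase j.1, by rw [Finset.card_erase_of_mem j.2, σ.2]; rfl⟩) := by
  simp [cechD]

/-- The maps applied to cochains are only additive, but signs are the only scalars in the Čech
differential. -/
theorem map_neg_one_pow_smul {M N : Type*} [AddCommGroup M] [Module A M] [AddCommGroup N]
    [Module A N] (f : M →+ N) (k : ℕ) (m : M) :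
    f ((-1 : A) ^ k • m) = (-1 : A) ^ k • f m := by
  rcases neg_one_pow_eq_or A k with h | h <;> simp [h]

theorem cechD_cochainMap {Ψ : ∀ σ, Loc x M σ →+ Loc x N σ}
    (hΨ : ∀ {τ σ} (h : τ ⊆ σ) z, Ψ σ (res x M h z) = res x N h (Ψ τ z)) {i : ℕ}
    (c : Cochain x M i) :
    cechD x N i (cochainMap x Ψ i c) = cochainMap x Ψ (i + 1) (cechD x M i c) := by
  ext σ
  rw [cochainMap_apply, cechD_apply, cechD_apply, map_sum]
  refine Finset.sum_congr rfl fun j _ => ?_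
  rw [map_neg_one_pow_smul, hΨ, cochainMap_apply]

theorem res_congr {i : ℕ} (c : Cochain x M i) {σ : Finset (Fin n)}
    (τ τ' : {σ : Finset (Fin n) // σ.card = i}) (e : τ = τ') (h : τ.1 ⊆ σ) (h' : τ'.1 ⊆ σ) :
    res x M h (c τ) = res x M h' (c τ') := by
  subst e
  rfl

theorem card_filter_erase_add {σ : Finset (Fin n)} {j k : Fin n} (hj : j ∈ σ) (h : j < k) :
    ((σ.erase j).filter (· < k)).card + 1 = (σ.filter (· < k)).card ∧
      ((σ.erase k).filter (· < j)).card = (σ.filter (· < j)).card := by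
  constructor
  · rw [Finset.filter_erase, Finset.card_erase_add_one]
    simp [hj, h]
  · congr 1
    ext a
    simp only [Finset.mem_filter, Finset.mem_erase]
    constructor
    · rintro ⟨⟨_, h1⟩, h2⟩
      exact ⟨h1, h2⟩
    · rintro ⟨h1, h2⟩
      exact ⟨⟨(h2.trans h).ne, h1⟩, h2⟩

/-- Erasing the smaller index lowers the position of the larger one by one, while erasing the larger
does not move the smaller. The two orders of erasure thus carry opposite signs. -/
theorem sign_erase_swap {σ : Finset (Fin n)} {j k : Fin n} (hj : j ∈ σ) (hk : k ∈ σ)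
    (h : j ≠ k) :
    (-1 : A) ^ (σ.filter (· < j)).card * (-1 : A) ^ ((σ.erase j).filter (· < k)).card +
      (-1 : A) ^ (σ.filter (· < k)).card * (-1 : A) ^ ((σ.erase k).filter (· < j)).card = 0 := by
  rcases lt_or_gt_of_ne h with h | h
  · obtain ⟨h1, h2⟩ := card_filter_erase_add hj h
    rw [← h1, h2]
    ring
  · obtain ⟨h1, h2⟩ := card_filter_erase_add hk h
    rw [← h1, h2]
    ring

/-- The terms cancel in pairs under the fixed-point-free involution that swaps the two erased
indices. -/
theorem cechD_cechD {i : ℕ} (c : Cochain x M i) : cechD x M (i + 1) (cechD x M i c) = 0 := by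
  ext σ
  rw [cechD_apply]
  simp only [cechD_apply, map_sum, Finset.smul_sum]
  rw [Finset.sum_sigma']
  refine Finset.sum_involution (fun p _ => ⟨⟨p.2.1, Finset.mem_of_mem_erase p.2.2⟩,
    ⟨p.1.1, Finset.mem_erase.2 ⟨(Finset.ne_of_mem_erase p.2.2).symm, p.1.2⟩⟩⟩) ?_ ?_ ?_ ?_
  · rintro ⟨⟨j, hj⟩, ⟨k, hk⟩⟩ _
    have hk' := Finset.mem_erase.1 hk
    dsimp only
    simp only [map_smul, res_res, smul_smul]
    rw [res_congr x c ⟨(σ.1.erase k).erase j, _⟩ ⟨(σ.1.erase j).erase k, by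
      rw [Finset.card_erase_of_mem hk, Finset.card_erase_of_mem hj, σ.2]; rfl⟩
      (Subtype.ext Finset.erase_right_comm) _
      ((Finset.erase_subset _ _).trans (Finset.erase_subset _ _)), ← add_smul,
      sign_erase_swap hj hk'.2 hk'.1.symm, zero_smul]
  · rintro ⟨⟨j, hj⟩, ⟨k, hk⟩⟩ _ _ h
    have hk' := Finset.mem_erase.1 hk
    simp only [Sigma.mk.injEq, Subtype.mk.injEq] at h
    exact hk'.1 h.1
  · intros
    simp
  · rintro ⟨⟨j, hj⟩, ⟨k, hk⟩⟩ _
    rfl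

end Fractions

/-! ### Graded pieces of the Čech complex, torsion of classes, and long exact sequences -/

section Graded

variable {A : Type*} [CommRing A] {n : ℕ} (x : Fin n → A) {M M' M'' : Type*}
  [AddCommGroup M] [Module A M] [AddCommGroup M'] [Module A M'] [AddCommGroup M''] [Module A M'']

/-- The elements `x j` have degree one with respect to the family `𝓜`. -/
def IsDegOne (𝓜 : ℤ → AddSubgroup M) : Prop := ∀ j t, ∀ m ∈ 𝓜 t, x j • m ∈ 𝓜 (t + 1)

variable {x} {𝓜 : ℤ → AddSubgroup M} {𝓜' : ℤ → AddSubgroup M'} {𝓜'' : ℤ → AddSubgroup M''}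

theorem IsDegOne.xProd_smul_mem (h : IsDegOne x 𝓜) (σ : Finset (Fin n)) {t : ℤ} {m : M}
    (hm : m ∈ 𝓜 t) : xProd x σ • m ∈ 𝓜 (t + σ.card) := by
  induction σ using Finset.induction_on with
  | empty => simpa [xProd] using hm
  | insert j σ hj ih =>
    have := h j _ _ ih
    rw [smul_smul] at this
    unfold xProd at this ⊢
    rw [Finset.prod_insert hj, Finset.card_insert_of_notMem hj]
    push_cast
    rwa [← add_assoc]

theorem IsDegOne.xProd_pow_smul_mem (h : IsDegOne x 𝓜) (σ : Finset (Fin n)) (k : ℕ) {t : ℤ} {m : M}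
    (hm : m ∈ 𝓜 t) : xProd x σ ^ k • m ∈ 𝓜 (t + k * σ.card) := by
  induction k with
  | zero => simpa using hm
  | succ k ih =>
    have := h.xProd_smul_mem σ ih
    rw [smul_smul, ← pow_succ'] at this
    convert this using 2
    push_cast
    ring

theorem IsDegOne.pow_smul_mem (h : IsDegOne x 𝓜) (j : Fin n) (k : ℕ) {t : ℤ} {m : M}
    (hm : m ∈ 𝓜 t) : x j ^ k • m ∈ 𝓜 (t + k) := by
  simpa [xProd] using h.xProd_pow_smul_mem {j} k hm

theorem frac_mem_locDeg {σ : Finset (Fin n)} {s : ℤ} {m : M} {k : ℕ}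
    (hm : m ∈ 𝓜 (s + k * σ.card)) : frac x σ m k ∈ locDeg x 𝓜 σ s :=
  AddSubgroup.subset_closure ⟨k, m, hm, rfl⟩

/-- Homogeneous fractions of equal degree stay homogeneous over a common denominator, so taking the
closure adds nothing. -/
theorem IsDegOne.mem_locDeg (h : IsDegOne x 𝓜) {σ : Finset (Fin n)} {s : ℤ} {z : Loc x M σ} :
    z ∈ locDeg x 𝓜 σ s ↔ ∃ (k : ℕ) (m : M), m ∈ 𝓜 (s + k * σ.card) ∧ z = frac x σ m k := by
  constructor
  · intro hz
    induction hz using AddSubgroup.closure_induction with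
    | mem z hz => exact hz
    | zero => exact ⟨0, 0, zero_mem _, (frac_zero x σ 0).symm⟩
    | add z w _ _ hz hw =>
      obtain ⟨k, m, hm, rfl⟩ := hz
      obtain ⟨l, m', hm', rfl⟩ := hw
      refine ⟨k + l, xProd x σ ^ l • m + xProd x σ ^ k • m', add_mem ?_ ?_, ?_⟩
      · convert h.xProd_pow_smul_mem σ l hm using 2
        push_cast
        ring
      · convert h.xProd_pow_smul_mem σ k hm' using 2
        push_cast
        ring
      · rw [frac_add, ← frac_expand, add_comm k l, ← frac_expand]
    | neg z _ hz =>
      obtain ⟨k, m, hm, rfl⟩ := hz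
      exact ⟨k, -m, neg_mem hm, (frac_neg x σ m k).symm⟩
  · rintro ⟨k, m, hm, rfl⟩
    exact frac_mem_locDeg hm

theorem IsDegOne.res_mem (h : IsDegOne x 𝓜) {τ σ : Finset (Fin n)} (hs : τ ⊆ σ) {s : ℤ}
    {z : Loc x M τ} (hz : z ∈ locDeg x 𝓜 τ s) : res x M hs z ∈ locDeg x 𝓜 σ s := by
  obtain ⟨k, m, hm, rfl⟩ := h.mem_locDeg.1 hz
  rw [res_frac]
  refine frac_mem_locDeg ?_
  convert h.xProd_pow_smul_mem (σ \ τ) k hm using 2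
  rw [← Finset.card_sdiff_add_card_eq_card hs]
  push_cast
  ring

theorem neg_one_pow_smul_mem (H : AddSubgroup M) (k : ℕ) {m : M} (hm : m ∈ H) :
    (-1 : A) ^ k • m ∈ H := by
  rcases neg_one_pow_eq_or A k with h | h <;> simpa [h] using hm

theorem mem_cochainDeg {i : ℕ} {s : ℤ} {c : Cochain x M i} :
    c ∈ cochainDeg x 𝓜 i s ↔ ∀ σ, c σ ∈ locDeg x 𝓜 σ.1 s := by
  simp [cochainDeg, AddSubgroup.mem_pi]

theorem IsDegOne.cechD_mem (h : IsDegOne x 𝓜) {i : ℕ} {s : ℤ} {c : Cochain x M i}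
    (hc : c ∈ cochainDeg x 𝓜 i s) : cechD x M i c ∈ cochainDeg x 𝓜 (i + 1) s := by
  rw [mem_cochainDeg] at hc ⊢
  intro σ
  rw [cechD_apply]
  refine AddSubgroup.sum_mem _ fun j _ => neg_one_pow_smul_mem _ _ ?_
  exact h.res_mem (Finset.erase_subset j.1 σ.1) (hc ⟨σ.1.erase j.1, _⟩)

variable (x 𝓜) in
/-- The coboundaries of homogeneous cochains of degree `s`. -/
def cobDeg : (i : ℕ) → ℤ → AddSubgroup (Cochain x M i)
  | 0, _ => ⊥
  | i + 1, s => (cochainDeg x 𝓜 i s).map (cechD x M i).toAddMonoidHom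

variable (x 𝓜) in
/-- Every cocycle of degree `s` in `C^i` is the coboundary of a cochain of degree `s`. -/
def DegExact (i : ℕ) (s : ℤ) : Prop :=
  ∀ z ∈ cochainDeg x 𝓜 i s, cechD x M i z = 0 → z ∈ cobDeg x 𝓜 i s

theorem cobDeg_le_cechB {i : ℕ} {s : ℤ} {z : Cochain x M i} (hz : z ∈ cobDeg x 𝓜 i s) :
    z ∈ cechB x M i := by
  cases i with
  | zero => exact hz
  | succ i =>
    obtain ⟨y, _, rfl⟩ := hz
    exact ⟨y, rfl⟩

theorem cechD_of_mem_cobDeg {i : ℕ} {s : ℤ} {z : Cochain x M i} (hz : z ∈ cobDeg x 𝓜 i s) :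
    cechD x M i z = 0 := by
  cases i with
  | zero =>
    rw [show z = 0 from hz, map_zero]
  | succ i =>
    obtain ⟨y, _, rfl⟩ := hz
    exact cechD_cechD x y

theorem IsDegOne.cobDeg_le (h : IsDegOne x 𝓜) {i : ℕ} {s : ℤ} {z : Cochain x M i}
    (hz : z ∈ cobDeg x 𝓜 i s) : z ∈ cochainDeg x 𝓜 i s := by
  cases i with
  | zero =>
    rw [show z = 0 from hz]
    exact zero_mem _
  | succ i =>
    obtain ⟨y, hy, rfl⟩ := hz
    exact h.cechD_mem hy

/-- A homogeneous degree part of the local cohomology vanishes iff the cocycles of that degree are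
coboundaries. -/
theorem localCohDeg_eq_bot {i : ℕ} {s : ℤ} :
    localCohDeg x 𝓜 i s = ⊥ ↔
      ∀ z ∈ cochainDeg x 𝓜 i s, cechD x M i z = 0 → z ∈ cechB x M i := by
  rw [localCohDeg, AddSubgroup.map_eq_bot_iff]
  constructor
  · intro h z hz hz'
    have := h (x := ⟨z, hz'⟩) hz
    have h2 := (Submodule.Quotient.mk_eq_zero _).1 (show Submodule.Quotient.mk _ = 0 from this)
    exact h2
  · intro h z hz
    exact (Submodule.Quotient.mk_eq_zero _).2 (h z.1 hz z.2)

theorem DegExact.localCohDeg_eq_bot {i : ℕ} {s : ℤ} (h : DegExact x 𝓜 i s) :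
    localCohDeg x 𝓜 i s = ⊥ :=
  SRRegularity.localCohDeg_eq_bot.2 fun z hz hz' => cobDeg_le_cechB (h z hz hz')

/-! #### Every class is killed by a power of each variable -/

/-- A power of x_j clears x_j from the denominator. Every larger exponent is allowed, so that one
exponent can serve finitely many τ. -/
theorem exists_res_eq_pow_smul (h : IsDegOne x 𝓜) {τ : Finset (Fin n)} {j : Fin n} (hj : j ∉ τ)
    {s : ℤ} {z : Loc x M (insert j τ)} (hz : z ∈ locDeg x 𝓜 (insert j τ) s) :
    ∃ N : ℕ, ∀ N' ≥ N, ∃ y ∈ locDeg x 𝓜 τ (s + N'),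
      res x M (Finset.subset_insert j τ) y = x j ^ N' • z := by
  obtain ⟨k, m, hm, rfl⟩ := h.mem_locDeg.1 hz
  refine ⟨k, fun N' hN => ?_⟩
  obtain ⟨r, rfl⟩ := Nat.exists_eq_add_of_le hN
  refine ⟨frac x τ (x j ^ r • m) k, frac_mem_locDeg ?_, ?_⟩
  · convert h.pow_smul_mem j r hm using 2
    rw [Finset.card_insert_of_notMem hj]
    push_cast
    ring
  · rw [res_frac, smul_frac, smul_smul, Finset.insert_sdiff_of_notMem _ hj, pow_add]
    simp [xProd]

theorem exists_pow_smul_eq_zero {τ : Finset (Fin n)} {j : Fin n} (hj : j ∉ τ)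
    {w : Loc x M τ} (hw : res x M (Finset.subset_insert j τ) w = 0) :
    ∃ N : ℕ, x j ^ N • w = 0 := by
  obtain ⟨m, k, rfl⟩ := exists_frac x w
  rw [res_frac, frac_eq_zero] at hw
  obtain ⟨c, hc⟩ := hw
  refine ⟨c + k, ?_⟩
  rw [smul_frac, frac_eq_zero]
  refine ⟨c, ?_⟩
  rw [← hc, smul_smul, smul_smul, Finset.insert_sdiff_of_notMem _ hj]
  simp only [xProd, Finset.prod_insert hj, sdiff_self, Finset.bot_eq_empty, insert_empty_eq,
    Finset.prod_singleton]
  congr 1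
  ring

/-- Contraction with j: the components of x_j^N z on faces containing j descend to the faces with j
removed and define a cochain there. Its coboundary agrees with x_j^N z on all faces containing j. -/
theorem exists_cobDeg_sub_vanish (h : IsDegOne x 𝓜) (j : Fin n) {i : ℕ} {s : ℤ}
    {z : Cochain x M i} (hz : z ∈ cochainDeg x 𝓜 i s) :
    ∃ N : ℕ, ∃ y ∈ cobDeg x 𝓜 i (s + N), ∀ σ, j ∈ σ.1 → (x j ^ N • z - y) σ = 0 := by
  cases i with
  | zero =>
    refine ⟨0, 0, zero_mem _, fun σ hσ => ?_⟩
    rw [Finset.card_eq_zero.1 σ.2] at hσ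
    simp at hσ
  | succ i =>
    rw [mem_cochainDeg] at hz
    have key (τ : {τ : Finset (Fin n) // τ.card = i}) : ∃ N : ℕ, ∀ N' ≥ N, ∀ hj : j ∉ τ.1,
        ∃ y ∈ locDeg x 𝓜 τ.1 (s + N'), res x M (Finset.subset_insert j τ.1) y =
          x j ^ N' • z ⟨insert j τ.1, by rw [Finset.card_insert_of_notMem hj, τ.2]⟩ := by
      by_cases hj : j ∈ τ.1
      · exact ⟨0, fun _ _ h => absurd hj h⟩
      · obtain ⟨N, hN⟩ := exists_res_eq_pow_smul h hj
          (hz ⟨insert j τ.1, by rw [Finset.card_insert_of_notMem hj, τ.2]⟩)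
        exact ⟨N, fun N' hN' _ => hN N' hN'⟩
    choose N hN using key
    have hle (τ) : N τ ≤ Finset.univ.sup N := Finset.le_sup (Finset.mem_univ τ)
    generalize Finset.univ.sup N = N₀ at hle
    choose Y hY hYz using fun τ => hN τ N₀ (hle τ)
    -- The sign cancels the one in the differential. Setting y to zero on faces containing j leaves
    -- a single term of the coboundary on a face containing j.
    let y : Cochain x M i := fun τ => if hj : j ∉ τ.1 then
      (-1 : A) ^ ((insert j τ.1).filter (· < j)).card • Y τ hj else 0
    refine ⟨N₀, cechD x M i y, ⟨y, ?_, rfl⟩, ?_⟩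
    · rw [SetLike.mem_coe, mem_cochainDeg]
      intro τ
      by_cases hj : j ∈ τ.1
      · simp only [y, hj, not_true_eq_false, dite_false, zero_mem]
      · simp only [y, hj, not_false_eq_true, dite_true]
        exact neg_one_pow_smul_mem _ _ (hY τ hj)
    · rintro ⟨σ, hσ⟩ hj
      dsimp only at hj
      obtain ⟨τ, hτ, rfl⟩ : ∃ τ, j ∉ τ ∧ σ = insert j τ :=
        ⟨σ.erase j, Finset.notMem_erase j σ, (Finset.insert_erase hj).symm⟩
      have hτi : τ.card = i := by
        rw [Finset.card_insert_of_notMem hτ] at hσ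
        omega
      rw [Pi.sub_apply, sub_eq_zero, cechD_apply,
        Finset.sum_eq_single ⟨j, Finset.mem_insert_self j τ⟩]
      · dsimp only
        rw [res_congr x y ⟨(insert j τ).erase j, by rw [Finset.erase_insert hτ, hτi]⟩ ⟨τ, hτi⟩
          (Subtype.ext (Finset.erase_insert hτ)) _
          (Finset.subset_insert j τ)]
        have hYτ := hYz ⟨τ, hτi⟩ hτ
        dsimp only [y] at hYτ ⊢
        rw [dif_pos hτ, map_smul, hYτ, smul_smul, ← mul_pow]
        simp
      · rintro ⟨k, hk⟩ _ hkj
        have : j ∈ (insert j τ).erase k :=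
          Finset.mem_erase.2 ⟨fun e => hkj (Subtype.ext e.symm), hj⟩
        dsimp only [y]
        rw [dif_neg (not_not.2 this), map_zero, smul_zero]
      · intro h
        exact absurd (Finset.mem_univ _) h

theorem cochain_pow_smul_mem (h : IsDegOne x 𝓜) (j : Fin n) {i : ℕ} {s : ℤ} (N : ℕ)
    {z : Cochain x M i} (hz : z ∈ cochainDeg x 𝓜 i s) :
    x j ^ N • z ∈ cochainDeg x 𝓜 i (s + N) := by
  rw [mem_cochainDeg] at hz ⊢
  intro σ
  obtain ⟨k, m, hm, e⟩ := h.mem_locDeg.1 (hz σ)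
  rw [Pi.smul_apply, e, smul_frac]
  refine frac_mem_locDeg ?_
  convert h.pow_smul_mem j N hm using 2
  ring

theorem cobDeg_pow_smul_mem (h : IsDegOne x 𝓜) (j : Fin n) {i : ℕ} {s : ℤ} (N : ℕ)
    {z : Cochain x M i} (hz : z ∈ cobDeg x 𝓜 i s) :
    x j ^ N • z ∈ cobDeg x 𝓜 i (s + N) := by
  cases i with
  | zero =>
    rw [show z = 0 from hz, smul_zero]
    exact zero_mem _
  | succ i =>
    obtain ⟨y, hy, rfl⟩ := hz
    exact ⟨x j ^ N • y, cochain_pow_smul_mem h j N hy, (cechD x M i).map_smul _ _⟩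

/-- Every cocycle becomes a coboundary after multiplication by a power of `x j`. -/
theorem exists_pow_smul_mem_cobDeg (h : IsDegOne x 𝓜) (j : Fin n) {i : ℕ} {s : ℤ}
    {z : Cochain x M i} (hz : z ∈ cochainDeg x 𝓜 i s) (hd : cechD x M i z = 0) :
    ∃ N : ℕ, x j ^ N • z ∈ cobDeg x 𝓜 i (s + N) := by
  obtain ⟨N, y, hy, hv⟩ := exists_cobDeg_sub_vanish h j hz
  have hw : cechD x M i (x j ^ N • z - y) = 0 := by
    rw [map_sub, map_smul, hd, cechD_of_mem_cobDeg hy, smul_zero, sub_zero]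
  have key (σ : {σ : Finset (Fin n) // σ.card = i}) :
      ∃ N' : ℕ, x j ^ N' • (x j ^ N • z - y) σ = 0 := by
    by_cases hj : j ∈ σ.1
    · exact ⟨0, by rw [hv σ hj, smul_zero]⟩
    · apply exists_pow_smul_eq_zero hj
      -- In the cocycle condition on σ ∪ {j} every face other than σ contains j and contributes
      -- zero, so the component at σ dies after inverting x_j.
      have := congrFun hw ⟨insert j σ.1, by rw [Finset.card_insert_of_notMem hj, σ.2]⟩
      rw [cechD_apply, Finset.sum_eq_single ⟨j, Finset.mem_insert_self j _⟩] at this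
      · rw [Pi.zero_apply] at this
        have h2 := congrArg (fun y => (-1 : A) ^
          ((insert j σ.1).filter (· < j)).card • y) this
        simp only [smul_smul, ← mul_pow, smul_zero] at h2
        rw [res_congr x _ ⟨(insert j σ.1).erase j, by rw [Finset.erase_insert hj, σ.2]⟩ σ
          (Subtype.ext (Finset.erase_insert hj)) _
          (Finset.subset_insert j σ.1)] at h2
        simpa using h2
      · rintro ⟨k, hk⟩ _ hkj
        have : j ∈ (insert j σ.1).erase k :=
          Finset.mem_erase.2 ⟨fun e => hkj (Subtype.ext e.symm), Finset.mem_insert_self _ _⟩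
        rw [hv ⟨(insert j σ.1).erase k, _⟩ this, map_zero, smul_zero]
      · intro h
        exact absurd (Finset.mem_univ _) h
  choose N' hN' using key
  refine ⟨Finset.univ.sup N' + N, ?_⟩
  have e : x j ^ Finset.univ.sup N' • (x j ^ N • z - y) = 0 := by
    ext σ
    obtain ⟨r, hr⟩ := Nat.exists_eq_add_of_le (Finset.le_sup (f := N') (Finset.mem_univ σ))
    rw [Pi.smul_apply, hr, add_comm, pow_add, mul_smul, hN' σ, smul_zero, Pi.zero_apply]
  rw [smul_sub, sub_eq_zero, smul_smul, ← pow_add] at e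
  rw [e]
  convert cobDeg_pow_smul_mem h j (Finset.univ.sup N') hy using 2
  push_cast
  ring

/-! #### Short exact sequences -/

variable (x) in
/-- The map of localizations induced by a linear map. -/
def locLin (f : M →ₗ[A] M') (σ : Finset (Fin n)) : Loc x M σ →+ Loc x M' σ :=
  locMap x 1 f.toAddMonoidHom (by simp) σ

theorem locLin_frac (f : M →ₗ[A] M') (σ : Finset (Fin n)) (m : M) (k : ℕ) :
    locLin x f σ (frac x σ m k) = frac x σ (f m) k := by
  rw [locLin, locMap_frac, mul_one]
  rfl

variable (x) in
/-- The map of Čech cochains induced by a linear map. -/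
def cochainLin (f : M →ₗ[A] M') (i : ℕ) : Cochain x M i →+ Cochain x M' i :=
  cochainMap x (locLin x f) i

theorem cechD_cochainLin (f : M →ₗ[A] M') {i : ℕ} (c : Cochain x M i) :
    cechD x M' i (cochainLin x f i c) = cochainLin x f (i + 1) (cechD x M i c) :=
  cechD_cochainMap x (fun h z => locMap_res x 1 _ _ h z) c

/-- A short exact sequence `0 → M'(-a) → M → M'' → 0` of graded modules. -/
structure IsGradedSES (𝓜' : ℤ → AddSubgroup M') (𝓜 : ℤ → AddSubgroup M)
    (𝓜'' : ℤ → AddSubgroup M'') (f : M' →ₗ[A] M) (g : M →ₗ[A] M'') (a : ℤ) : Prop where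
  inj : Function.Injective f
  map_f : ∀ t, ∀ m ∈ 𝓜' t, f m ∈ 𝓜 (t + a)
  map_g : ∀ t, ∀ m ∈ 𝓜 t, g m ∈ 𝓜'' t
  lift : ∀ t, ∀ m'' ∈ 𝓜'' t, ∃ m ∈ 𝓜 t, g m = m''
  exact : ∀ t, ∀ m ∈ 𝓜 t, g m = 0 → ∃ m' ∈ 𝓜' (t - a), f m' = m
  comp : ∀ m, g (f m) = 0

section LES

variable {f : M' →ₗ[A] M} {g : M →ₗ[A] M''} {a : ℤ} (H : IsGradedSES 𝓜' 𝓜 𝓜'' f g a)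
include H

theorem IsGradedSES.cochainLin_injective (i : ℕ) : Function.Injective (cochainLin x f i) := by
  rw [injective_iff_map_eq_zero]
  intro c hc
  ext σ
  have := congrFun hc σ
  rw [cochainLin, cochainMap_apply] at this
  obtain ⟨m, k, e⟩ := exists_frac x (c σ)
  rw [e, locLin_frac, Pi.zero_apply, frac_eq_zero] at this
  obtain ⟨l, hl⟩ := this
  rw [← map_smul, map_eq_zero_iff f H.inj] at hl
  rw [e, Pi.zero_apply, frac_eq_zero]
  exact ⟨l, hl⟩

theorem IsGradedSES.cochainLin_comp {i : ℕ} (c : Cochain x M' i) :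
    cochainLin x g i (cochainLin x f i c) = 0 := by
  ext σ
  simp only [cochainLin, cochainMap_apply]
  obtain ⟨m, k, e⟩ := exists_frac x (c σ)
  rw [e, locLin_frac, locLin_frac, H.comp, frac_zero, Pi.zero_apply]

variable (h' : IsDegOne x 𝓜') (h : IsDegOne x 𝓜) (h'' : IsDegOne x 𝓜'')

include h' in
theorem IsGradedSES.cochainLin_f_mem {i : ℕ} {s : ℤ} {c : Cochain x M' i}
    (hc : c ∈ cochainDeg x 𝓜' i s) : cochainLin x f i c ∈ cochainDeg x 𝓜 i (s + a) := by
  rw [mem_cochainDeg] at hc ⊢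
  intro σ
  obtain ⟨k, m, hm, e⟩ := h'.mem_locDeg.1 (hc σ)
  rw [cochainLin, cochainMap_apply, e, locLin_frac]
  refine frac_mem_locDeg ?_
  rw [add_right_comm]
  exact H.map_f _ _ hm

include h in
theorem IsGradedSES.cochainLin_g_mem {i : ℕ} {s : ℤ} {c : Cochain x M i}
    (hc : c ∈ cochainDeg x 𝓜 i s) : cochainLin x g i c ∈ cochainDeg x 𝓜'' i s := by
  rw [mem_cochainDeg] at hc ⊢
  intro σ
  obtain ⟨k, m, hm, e⟩ := h.mem_locDeg.1 (hc σ)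
  rw [cochainLin, cochainMap_apply, e, locLin_frac]
  exact frac_mem_locDeg (H.map_g _ _ hm)

include h'' in
theorem IsGradedSES.exists_lift {i : ℕ} {s : ℤ} {c : Cochain x M'' i}
    (hc : c ∈ cochainDeg x 𝓜'' i s) : ∃ b ∈ cochainDeg x 𝓜 i s, cochainLin x g i b = c := by
  rw [mem_cochainDeg] at hc
  have key (σ : {σ : Finset (Fin n) // σ.card = i}) :
      ∃ b ∈ locDeg x 𝓜 σ.1 s, locLin x g σ.1 b = c σ := by
    obtain ⟨k, m, hm, e⟩ := h''.mem_locDeg.1 (hc σ)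
    obtain ⟨b, hb, rfl⟩ := H.lift _ _ hm
    exact ⟨frac x σ.1 b k, frac_mem_locDeg hb, by rw [locLin_frac, e]⟩
  choose b hb hb' using key
  exact ⟨b, mem_cochainDeg.2 hb, funext hb'⟩

include h in
theorem IsGradedSES.exists_preimage {i : ℕ} {s : ℤ} {c : Cochain x M i}
    (hc : c ∈ cochainDeg x 𝓜 i s) (hg : cochainLin x g i c = 0) :
    ∃ b ∈ cochainDeg x 𝓜' i (s - a), cochainLin x f i b = c := by
  rw [mem_cochainDeg] at hc
  have key (σ : {σ : Finset (Fin n) // σ.card = i}) :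
      ∃ b ∈ locDeg x 𝓜' σ.1 (s - a), locLin x f σ.1 b = c σ := by
    obtain ⟨k, m, hm, e⟩ := h.mem_locDeg.1 (hc σ)
    have h0 := congrFun hg σ
    rw [cochainLin, cochainMap_apply, e, locLin_frac, Pi.zero_apply, frac_eq_zero] at h0
    obtain ⟨l, hl⟩ := h0
    rw [← map_smul] at hl
    obtain ⟨b, hb, hb'⟩ := H.exact _ _ (h.xProd_pow_smul_mem σ.1 l hm) hl
    refine ⟨frac x σ.1 b (k + l), frac_mem_locDeg ?_, ?_⟩
    · convert hb using 2
      push_cast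
      ring
    · rw [locLin_frac, hb', e, ← frac_expand]
  choose b hb hb' using key
  exact ⟨b, mem_cochainDeg.2 hb, funext hb'⟩

include h' in
theorem IsGradedSES.cobDeg_f_mem {i : ℕ} {s : ℤ} {c : Cochain x M' i}
    (hc : c ∈ cobDeg x 𝓜' i s) : cochainLin x f i c ∈ cobDeg x 𝓜 i (s + a) := by
  cases i with
  | zero =>
    rw [show c = 0 from hc, map_zero]
    exact zero_mem _
  | succ i =>
    obtain ⟨y, hy, rfl⟩ := hc
    exact ⟨_, H.cochainLin_f_mem h' hy, cechD_cochainLin f y⟩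

include h in
theorem IsGradedSES.cobDeg_g_mem {i : ℕ} {s : ℤ} {c : Cochain x M i}
    (hc : c ∈ cobDeg x 𝓜 i s) : cochainLin x g i c ∈ cobDeg x 𝓜'' i s := by
  cases i with
  | zero =>
    rw [show c = 0 from hc, map_zero]
    exact zero_mem _
  | succ i =>
    obtain ⟨y, hy, rfl⟩ := hc
    exact ⟨_, H.cochainLin_g_mem h hy, cechD_cochainLin g y⟩

include h'' in
theorem IsGradedSES.exists_cobDeg_lift {i : ℕ} {s : ℤ} {c : Cochain x M'' i}
    (hc : c ∈ cobDeg x 𝓜'' i s) : ∃ b ∈ cobDeg x 𝓜 i s, cochainLin x g i b = c := by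
  cases i with
  | zero => exact ⟨0, zero_mem _, by rw [show c = 0 from hc, map_zero]⟩
  | succ i =>
    obtain ⟨y, hy, rfl⟩ := hc
    obtain ⟨b, hb, rfl⟩ := H.exists_lift h'' hy
    exact ⟨_, ⟨b, hb, rfl⟩, (cechD_cochainLin g b).symm⟩

include h' h h''

/-- Exactness of H^i(M') → H^i(M) → H^i(M''): after subtracting a lifted coboundary, the cocycle
comes from M'. -/
theorem IsGradedSES.degExact_middle {i : ℕ} {s : ℤ} (e' : DegExact x 𝓜' i (s - a))
    (e'' : DegExact x 𝓜'' i s) : DegExact x 𝓜 i s := by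
  intro z hz hd
  obtain ⟨b, hb, hbz⟩ := H.exists_cobDeg_lift h'' (e'' _ (H.cochainLin_g_mem h hz)
    (by rw [cechD_cochainLin, hd, map_zero]))
  obtain ⟨w, hw, hwz⟩ := H.exists_preimage h (sub_mem hz (h.cobDeg_le hb))
    (by rw [map_sub, hbz, sub_self])
  have hdw : cechD x M' i w = 0 := by
    apply H.cochainLin_injective (x := x)
    rw [← cechD_cochainLin, hwz, map_sub, hd, cechD_of_mem_cobDeg hb, sub_zero, map_zero]
  have := H.cobDeg_f_mem h' (e' w hw hdw)
  rw [sub_add_cancel, hwz] at this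
  simpa using add_mem this hb

/-- Exactness of H^i(M) → H^i(M'') → H^(i+1)(M'), the second arrow being the connecting map. -/
theorem IsGradedSES.degExact_right {i : ℕ} {s : ℤ} (e' : DegExact x 𝓜' (i + 1) (s - a))
    (e : DegExact x 𝓜 i s) : DegExact x 𝓜'' i s := by
  intro z'' hz'' hd''
  obtain ⟨z, hz, rfl⟩ := H.exists_lift h'' hz''
  rw [cechD_cochainLin] at hd''
  obtain ⟨w, hw, hwz⟩ := H.exists_preimage h (h.cechD_mem hz) hd''
  have hdw : cechD x M' (i + 1) w = 0 := by
    apply H.cochainLin_injective (x := x)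
    rw [← cechD_cochainLin, hwz, cechD_cechD, map_zero]
  obtain ⟨v, hv, rfl⟩ := e' w hw hdw
  have hv' := H.cochainLin_f_mem h' hv
  rw [sub_add_cancel] at hv'
  have := H.cobDeg_g_mem h (e _ (sub_mem hz hv')
    (by rw [map_sub, cechD_cochainLin, ← hwz]; exact sub_self _))
  rwa [map_sub, H.cochainLin_comp, sub_zero] at this

end LES

theorem cochainLin_lsmul (b : A) {i : ℕ} (c : Cochain x M i) :
    cochainLin x (LinearMap.lsmul A M b) i c = b • c := by
  ext σ
  rw [cochainLin, cochainMap_apply, Pi.smul_apply]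
  obtain ⟨m, k, e⟩ := exists_frac x (c σ)
  rw [e, locLin_frac, smul_frac]
  rfl

/-- If `x j` is regular on `M`, the vanishing of `H^i(M / x j M)` in high degrees implies that of
`H^(i+1)(M)`. -/
theorem degExact_succ_of_regular {g : M →ₗ[A] M''} (j : Fin n)
    (H : IsGradedSES 𝓜 𝓜 𝓜'' (LinearMap.lsmul A M (x j)) g 1) (h : IsDegOne x 𝓜)
    (h'' : IsDegOne x 𝓜'') {i : ℕ} {s₀ : ℤ} (e : ∀ s ≥ s₀, DegExact x 𝓜'' i s) :
    ∀ s ≥ s₀ - 1, DegExact x 𝓜 (i + 1) s := by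
  -- Multiplication by `x j` is injective on H^(i+1)(M)_s: its kernel is the image of the connecting
  -- map from H^i(M'')_(s+1), which is zero. As every class is killed by a power of `x j`, every
  -- class then vanishes.
  have step (s : ℤ) (hs : s ≥ s₀ - 1) (u : Cochain x M (i + 1))
      (hu : u ∈ cochainDeg x 𝓜 (i + 1) s)
      (hxu : x j • u ∈ cobDeg x 𝓜 (i + 1) (s + 1)) : u ∈ cobDeg x 𝓜 (i + 1) s := by
    obtain ⟨y, hy, hyu⟩ := hxu
    replace hyu : cechD x M i y = x j • u := hyu
    have hgy : cechD x M'' i (cochainLin x g i y) = 0 := by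
      rw [cechD_cochainLin, hyu, ← cochainLin_lsmul, H.cochainLin_comp]
    obtain ⟨b, hb, hby⟩ := H.exists_cobDeg_lift h''
      (e (s + 1) (by omega) _ (H.cochainLin_g_mem h hy) hgy)
    obtain ⟨w, hw, hwy⟩ := H.exists_preimage h (sub_mem hy (h.cobDeg_le hb))
      (by rw [map_sub, hby, sub_self])
    rw [add_sub_cancel_right] at hw
    refine ⟨w, hw, ?_⟩
    apply H.cochainLin_injective (x := x)
    rw [cochainLin_lsmul _ u, ← hyu]
    change cochainLin x _ (i + 1) (cechD x M i w) = _
    rw [← cechD_cochainLin, hwy, map_sub, cechD_of_mem_cobDeg hb, sub_zero]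
  have steps (N : ℕ) : ∀ (s : ℤ) (_ : s ≥ s₀ - 1) (u : Cochain x M (i + 1))
      (_ : u ∈ cochainDeg x 𝓜 (i + 1) s)
      (_ : x j ^ N • u ∈ cobDeg x 𝓜 (i + 1) (s + N)), u ∈ cobDeg x 𝓜 (i + 1) s := by
    induction N with
    | zero =>
      intro s _ u _ hxu
      simpa using hxu
    | succ N ih =>
      intro s hs u hu hxu
      refine ih s hs u hu (step _ (by omega) _ (cochain_pow_smul_mem h j N hu) ?_)
      rw [smul_smul, ← pow_succ']
      convert hxu using 2
      push_cast
      ring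
  intro s hs z hz hd
  obtain ⟨N, hN⟩ := exists_pow_smul_mem_cobDeg h j hz hd
  exact steps N s hs z hz hN

/-- H^0 consists of elements killed by powers of x_j, and a regular x_j kills none but zero. -/
theorem degExact_zero_of_regular (j : Fin n) (h : IsDegOne x 𝓜)
    (hj : ∀ m : M, x j • m = 0 → m = 0) (s : ℤ) : DegExact x 𝓜 0 s := by
  intro z hz hd
  obtain ⟨N, hN⟩ := exists_pow_smul_mem_cobDeg h j hz hd
  replace hN : x j ^ N • z = 0 := hN
  change z = 0
  ext σ
  have := congrFun hN σ
  obtain ⟨m, k, e⟩ := exists_frac x (z σ)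
  rw [Pi.smul_apply, e, smul_frac, Pi.zero_apply, frac_eq_zero] at this
  obtain ⟨c, hc⟩ := this
  rw [e, Pi.zero_apply, frac_eq_zero]
  have hp (N : ℕ) : ∀ m : M, x j ^ N • m = 0 → m = 0 := by
    induction N with
    | zero => simp
    | succ N ih =>
      intro m hm
      rw [pow_succ, mul_smul] at hm
      exact hj _ (ih _ hm)
  rw [smul_comm] at hc
  exact ⟨c, hp N _ hc⟩

end Graded

/-! ### Graded quotients of S: finiteness, Grothendieck vanishing and nonvanishing -/

section Polynomial

variable {K : Type*} [Field K] {n : ℕ}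

/-- The homogeneous component of (integral) degree `t` of a polynomial. -/
abbrev component (t : ℤ) : MvPolynomial (Fin n) K →ₗ[K] MvPolynomial (Fin n) K :=
  weightedHomogeneousComponent (fun _ : Fin n => (1 : ℤ)) t

theorem weight_one_int (d : Fin n →₀ ℕ) :
    Finsupp.weight (fun _ : Fin n => (1 : ℤ)) d = d.degree := by
  simp [Finsupp.weight_apply, Finsupp.sum, Finsupp.degree_apply]

theorem coeff_component (t : ℤ) (f : MvPolynomial (Fin n) K) (d : Fin n →₀ ℕ) :
    coeff d (component t f) = if (d.degree : ℤ) = t then coeff d f else 0 := by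
  rw [coeff_weightedHomogeneousComponent, weight_one_int]

theorem component_X_mul (t : ℤ) (j : Fin n) (f : MvPolynomial (Fin n) K) :
    component t (X j * f) = X j * component (t - 1) f := by
  ext d
  rw [coeff_component, coeff_X_mul', coeff_X_mul', coeff_component]
  by_cases hj : j ∈ d.support
  · have h1 : d = Finsupp.single j 1 + (d - Finsupp.single j 1) := by
      rw [add_tsub_cancel_of_le]
      rw [Finsupp.single_le_iff]
      exact Nat.one_le_iff_ne_zero.2 (Finsupp.mem_support_iff.1 hj)
    have h2 := congrArg Finsupp.degree h1
    rw [map_add, Finsupp.degree_single] at h2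
    simp only [if_pos hj]
    split_ifs <;> first | rfl | omega
  · simp only [if_neg hj, ite_self]

/-- An ideal is homogeneous if it contains the components of its elements. -/
def IsHomog (𝔞 : Ideal (MvPolynomial (Fin n) K)) : Prop := ∀ f ∈ 𝔞, ∀ t : ℤ, component t f ∈ 𝔞

theorem IsHomog.sup_X {𝔞 : Ideal (MvPolynomial (Fin n) K)} (h : IsHomog 𝔞) (j : Fin n) :
    IsHomog (𝔞 ⊔ Ideal.span {X j}) := by
  intro f hf t
  obtain ⟨u, hu, v, hv, rfl⟩ := Submodule.mem_sup.1 hf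
  obtain ⟨c, rfl⟩ := Ideal.mem_span_singleton.1 hv
  rw [map_add, component_X_mul]
  exact Submodule.add_mem_sup (h u hu t)
    (Ideal.mem_span_singleton.2 (dvd_mul_right _ _))

theorem IsHomog.colon_X {𝔞 : Ideal (MvPolynomial (Fin n) K)} (h : IsHomog 𝔞) (j : Fin n) :
    IsHomog (𝔞.colon {X j}) := by
  intro f hf t
  rw [Submodule.mem_colon_singleton, smul_eq_mul, mul_comm] at hf ⊢
  have := h _ hf (t + 1)
  rwa [component_X_mul, add_sub_cancel_right] at this

theorem mem_degPart {B : Type*} [CommRing B] [Algebra (MvPolynomial (Fin n) K) B] {t : ℤ} {b : B} :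
    b ∈ degPart K n B t ↔ ∃ f : MvPolynomial (Fin n) K,
      IsWeightedHomogeneous (fun _ : Fin n => (1 : ℤ)) f t ∧ algebraMap _ B f = b :=
  Iff.rfl

theorem isDegOne_degPart (B : Type*) [CommRing B] [Algebra (MvPolynomial (Fin n) K) B] :
    IsDegOne (X : Fin n → MvPolynomial (Fin n) K) (degPart K n B) := by
  rintro j t _ ⟨f, hf, rfl⟩
  refine ⟨X j * f, ?_, ?_⟩
  · have := (isWeightedHomogeneous_X K (fun _ : Fin n => (1 : ℤ)) j).mul hf
    rwa [add_comm] at this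
  · exact (map_mul (algebraMap (MvPolynomial (Fin n) K) B) _ _).trans (Algebra.smul_def _ _).symm

/-- Multiplication by `b` as a map `S / (𝔞 : b) → S / 𝔞`. -/
def colonMul {S : Type*} [CommRing S] (𝔞 : Ideal S) (b : S) : (S ⧸ 𝔞.colon {b}) →ₗ[S] S ⧸ 𝔞 :=
  Submodule.mapQ (𝔞.colon {b}) 𝔞 (LinearMap.lsmul S S b) (by
    intro f hf
    have := Submodule.mem_colon_singleton.1 hf
    simpa [mul_comm] using this)

theorem colonMul_mk {S : Type*} [CommRing S] (𝔞 : Ideal S) (b f : S) :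
    colonMul 𝔞 b (Ideal.Quotient.mk _ f) = Ideal.Quotient.mk 𝔞 (b * f) := rfl

theorem colonMul_injective {S : Type*} [CommRing S] (𝔞 : Ideal S) (b : S) :
    Function.Injective (colonMul 𝔞 b) := by
  rw [injective_iff_map_eq_zero]
  intro m hm
  obtain ⟨f, rfl⟩ := Ideal.Quotient.mk_surjective m
  rw [colonMul_mk, Ideal.Quotient.eq_zero_iff_mem] at hm
  rw [Ideal.Quotient.eq_zero_iff_mem, Submodule.mem_colon_singleton]
  simpa [mul_comm] using hm

/-- The projection `S / 𝔞 → S / (𝔞 + (b))`. -/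
def projSup {S : Type*} [CommRing S] (𝔞 : Ideal S) (b : S) :
    (S ⧸ 𝔞) →ₗ[S] S ⧸ (𝔞 ⊔ Ideal.span {b}) :=
  Submodule.mapQ 𝔞 (𝔞 ⊔ Ideal.span {b}) LinearMap.id le_sup_left

theorem projSup_mk {S : Type*} [CommRing S] (𝔞 : Ideal S) (b f : S) :
    projSup 𝔞 b (Ideal.Quotient.mk _ f) = Ideal.Quotient.mk _ f := rfl

theorem mk_mul_sup {S : Type*} [CommRing S] (𝔞 : Ideal S) (b f : S) :
    Ideal.Quotient.mk (𝔞 ⊔ Ideal.span {b}) (b * f) = 0 := by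
  rw [Ideal.Quotient.eq_zero_iff_mem]
  exact Ideal.mem_sup_right (Ideal.mem_span_singleton.2 (dvd_mul_right _ _))

/-- If f = u + x_j c with u ∈ 𝔞, homogeneity of 𝔞 allows c to be replaced by its component of degree
t - 1. -/
theorem exists_homog_mul {𝔞 : Ideal (MvPolynomial (Fin n) K)} (h : IsHomog 𝔞) (j : Fin n) {t : ℤ}
    {m : MvPolynomial (Fin n) K ⧸ 𝔞} (hm : m ∈ degPart K n _ t) (h0 : projSup 𝔞 (X j) m = 0) :
    ∃ v : MvPolynomial (Fin n) K, IsWeightedHomogeneous (fun _ : Fin n => (1 : ℤ)) v (t - 1) ∧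
      Ideal.Quotient.mk 𝔞 (X j * v) = m := by
  obtain ⟨f, hf, rfl⟩ := mem_degPart.1 hm
  have h0' : Ideal.Quotient.mk (𝔞 ⊔ Ideal.span {X j}) f = 0 := h0
  rw [Ideal.Quotient.eq_zero_iff_mem] at h0'
  obtain ⟨u, hu, v, hv, e⟩ := Submodule.mem_sup.1 h0'
  obtain ⟨c, rfl⟩ := Ideal.mem_span_singleton.1 hv
  refine ⟨component (t - 1) c, weightedHomogeneousComponent_isWeightedHomogeneous _ _, ?_⟩
  have e2 := congrArg (component t) e
  rw [map_add, component_X_mul, hf.weightedHomogeneousComponent_same] at e2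
  change _ = Ideal.Quotient.mk 𝔞 f
  rw [← e2, map_add, Ideal.Quotient.eq_zero_iff_mem.2 (h u hu t), zero_add]

theorem mk_mem_degPart {𝔞 : Ideal (MvPolynomial (Fin n) K)} {t : ℤ} {f : MvPolynomial (Fin n) K}
    (hf : IsWeightedHomogeneous (fun _ : Fin n => (1 : ℤ)) f t) :
    Ideal.Quotient.mk 𝔞 f ∈ degPart K n (MvPolynomial (Fin n) K ⧸ 𝔞) t :=
  ⟨f, hf, rfl⟩

theorem isGradedSES_colon {𝔞 : Ideal (MvPolynomial (Fin n) K)} (h : IsHomog 𝔞) (j : Fin n) :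
    IsGradedSES (degPart K n (MvPolynomial (Fin n) K ⧸ 𝔞.colon {X j}))
      (degPart K n (MvPolynomial (Fin n) K ⧸ 𝔞))
      (degPart K n (MvPolynomial (Fin n) K ⧸ (𝔞 ⊔ Ideal.span {X j})))
      (colonMul 𝔞 (X j)) (projSup 𝔞 (X j)) 1 where
  inj := colonMul_injective 𝔞 (X j)
  map_f := by
    rintro t _ ⟨f, hf, rfl⟩
    refine mk_mem_degPart (f := X j * f) ?_
    rw [add_comm]
    exact (isWeightedHomogeneous_X K _ j).mul hf
  map_g := by
    rintro t _ ⟨f, hf, rfl⟩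
    exact mk_mem_degPart hf
  lift := by
    rintro t _ ⟨f, hf, rfl⟩
    exact ⟨_, mk_mem_degPart hf, rfl⟩
  exact := by
    intro t m hm h0
    obtain ⟨v, hv, rfl⟩ := exists_homog_mul h j hm h0
    exact ⟨_, mk_mem_degPart hv, rfl⟩
  comp := by
    intro m
    obtain ⟨f, rfl⟩ := Ideal.Quotient.mk_surjective m
    exact mk_mul_sup 𝔞 (X j) f

theorem isGradedSES_regular {𝔞 : Ideal (MvPolynomial (Fin n) K)} (h : IsHomog 𝔞) (j : Fin n)
    (hj : Function.Injective (LinearMap.lsmul (MvPolynomial (Fin n) K)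
      (MvPolynomial (Fin n) K ⧸ 𝔞) (X j))) :
    IsGradedSES (degPart K n (MvPolynomial (Fin n) K ⧸ 𝔞))
      (degPart K n (MvPolynomial (Fin n) K ⧸ 𝔞))
      (degPart K n (MvPolynomial (Fin n) K ⧸ (𝔞 ⊔ Ideal.span {X j})))
      (LinearMap.lsmul _ _ (X j)) (projSup 𝔞 (X j)) 1 where
  inj := hj
  map_f := fun t m hm => isDegOne_degPart _ j t m hm
  map_g := by
    rintro t _ ⟨f, hf, rfl⟩
    exact mk_mem_degPart hf
  lift := by
    rintro t _ ⟨f, hf, rfl⟩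
    exact ⟨_, mk_mem_degPart hf, rfl⟩
  exact := by
    intro t m hm h0
    obtain ⟨v, hv, rfl⟩ := exists_homog_mul h j hm h0
    exact ⟨_, mk_mem_degPart hv, rfl⟩
  comp := by
    intro m
    obtain ⟨f, rfl⟩ := Ideal.Quotient.mk_surjective m
    exact mk_mul_sup 𝔞 (X j) f

/-- Noetherian induction on homogeneous ideals, by adding variables and taking colon ideals. -/
theorem homogeneous_induction {P : Ideal (MvPolynomial (Fin n) K) → Prop}
    (base : ∀ 𝔞, IsHomog 𝔞 → (∀ j, X j ∈ 𝔞) → P 𝔞)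
    (colon : ∀ 𝔞, IsHomog 𝔞 → ∀ j, P (𝔞.colon {X j}) → P (𝔞 ⊔ Ideal.span {X j}) → P 𝔞)
    (regular : ∀ 𝔞, IsHomog 𝔞 → ∀ j, Function.Injective (LinearMap.lsmul (MvPolynomial (Fin n) K)
      (MvPolynomial (Fin n) K ⧸ 𝔞) (X j)) → P (𝔞 ⊔ Ideal.span {X j}) → P 𝔞)
    (𝔞 : Ideal (MvPolynomial (Fin n) K)) (h : IsHomog 𝔞) : P 𝔞 := by
  induction 𝔞 using IsNoetherian.induction with
  | _ 𝔞 ih =>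
  by_cases hX : ∀ j, X j ∈ 𝔞
  · exact base 𝔞 h hX
  push Not at hX
  obtain ⟨j, hj⟩ := hX
  have h2 : P (𝔞 ⊔ Ideal.span {X j}) := by
    refine ih _ (lt_of_le_of_ne le_sup_left fun e => hj ?_) (h.sup_X j)
    rw [e]
    exact Ideal.mem_sup_right (Ideal.mem_span_singleton_self _)
  have hle : 𝔞 ≤ 𝔞.colon {X j} := fun f hf =>
    Submodule.mem_colon_singleton.2 (Ideal.mul_mem_right _ 𝔞 hf)
  -- Either x_j is regular modulo 𝔞, or the colon ideal is strictly larger and the induction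
  -- hypothesis applies to it as well.
  by_cases he : 𝔞 = 𝔞.colon {X j}
  · refine regular 𝔞 h j ?_ h2
    rw [injective_iff_map_eq_zero]
    intro m hm
    obtain ⟨f, rfl⟩ := Ideal.Quotient.mk_surjective m
    have hm' : Ideal.Quotient.mk 𝔞 (X j * f) = 0 := hm
    rw [Ideal.Quotient.eq_zero_iff_mem] at hm' ⊢
    rw [he, Submodule.mem_colon_singleton, smul_eq_mul, mul_comm]
    exact hm'
  · exact colon 𝔞 h j (ih _ (lt_of_le_of_ne hle he) (h.colon_X j)) h2

section Base

variable {A : Type*} [CommRing A] {x : Fin n → A} {M : Type*} [AddCommGroup M] [Module A M]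

theorem frac_eq_zero_of_torsion (hx : ∀ j (m : M), x j • m = 0) {σ : Finset (Fin n)}
    (hσ : σ.Nonempty) (m : M) (k : ℕ) : frac x σ m k = 0 := by
  obtain ⟨j, hj⟩ := hσ
  rw [frac_eq_zero]
  refine ⟨1, ?_⟩
  rw [pow_one, xProd, ← Finset.mul_prod_erase _ _ hj, mul_comm, mul_smul, hx, smul_zero]

theorem degExact_succ_of_torsion (hx : ∀ j (m : M), x j • m = 0) (𝓜 : ℤ → AddSubgroup M) (i : ℕ)
    (s : ℤ) : DegExact x 𝓜 (i + 1) s := by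
  intro z _ _
  have : z = 0 := by
    ext σ
    obtain ⟨m, k, e⟩ := exists_frac x (z σ)
    rw [e, Pi.zero_apply]
    refine frac_eq_zero_of_torsion hx (Finset.card_pos.1 ?_) m k
    rw [σ.2]
    exact Nat.succ_pos i
  rw [this]
  exact zero_mem _

theorem degExact_zero_of_eq_bot {𝓜 : ℤ → AddSubgroup M} (h : IsDegOne x 𝓜) {s : ℤ}
    (hs : 𝓜 s = ⊥) : DegExact x 𝓜 0 s := by
  intro z hz _
  change z = 0
  ext σ
  obtain ⟨k, m, hm, e⟩ := h.mem_locDeg.1 (mem_cochainDeg.1 hz σ)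
  rw [σ.2, Nat.cast_zero, mul_zero, add_zero, hs, AddSubgroup.mem_bot] at hm
  rw [e, hm, frac_zero, Pi.zero_apply]

theorem degExact_of_subsingleton [Subsingleton M] (𝓜 : ℤ → AddSubgroup M) (i : ℕ)
    (s : ℤ) : DegExact x 𝓜 i s := by
  intro z _ _
  have : z = 0 := by
    ext σ
    obtain ⟨m, k, e⟩ := exists_frac x (z σ)
    rw [e, Subsingleton.elim m 0, frac_zero, Pi.zero_apply]
  rw [this]
  exact zero_mem _

end Base

theorem X_smul_eq_zero {𝔞 : Ideal (MvPolynomial (Fin n) K)} (hX : ∀ j, X j ∈ 𝔞) (j : Fin n)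
    (m : MvPolynomial (Fin n) K ⧸ 𝔞) : (X j : MvPolynomial (Fin n) K) • m = 0 := by
  obtain ⟨f, rfl⟩ := Ideal.Quotient.mk_surjective m
  exact Ideal.Quotient.eq_zero_iff_mem.2 (𝔞.mul_mem_right _ (hX j))

theorem mem_of_isWeightedHomogeneous {𝔞 : Ideal (MvPolynomial (Fin n) K)} (hX : ∀ j, X j ∈ 𝔞)
    {s : ℤ} (hs : s ≠ 0) {f : MvPolynomial (Fin n) K}
    (hf : IsWeightedHomogeneous (fun _ : Fin n => (1 : ℤ)) f s) : f ∈ 𝔞 := by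
  rw [← support_sum_monomial_coeff f]
  refine sum_mem fun d hd => ?_
  have h1 := hf (mem_support_iff.1 hd)
  have hd0 : d ≠ 0 := by
    rintro rfl
    rw [map_zero] at h1
    exact hs h1.symm
  obtain ⟨j, hj⟩ := Finsupp.ne_iff.1 hd0
  exact 𝔞.mem_of_dvd (X_dvd_monomial.2 (Or.inr hj)) (hX j)

/-- The local cohomology of a graded quotient of `S` vanishes in high degrees. -/
theorem exists_degExact {𝔞 : Ideal (MvPolynomial (Fin n) K)} (h : IsHomog 𝔞) :
    ∃ s₀ : ℤ, ∀ i, ∀ s ≥ s₀, DegExact (X : Fin n → MvPolynomial (Fin n) K)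
      (degPart K n (MvPolynomial (Fin n) K ⧸ 𝔞)) i s := by
  refine homogeneous_induction (P := fun 𝔞 => ∃ s₀ : ℤ, ∀ i, ∀ s ≥ s₀,
    DegExact (X : Fin n → MvPolynomial (Fin n) K) (degPart K n (MvPolynomial (Fin n) K ⧸ 𝔞)) i s)
    ?_ ?_ ?_ 𝔞 h
  · intro 𝔞 h hX
    -- Here S/𝔞 is killed by all variables, so it lives in degree 0 and its higher local cohomology
    -- is zero.
    refine ⟨1, fun i s hs => ?_⟩
    cases i with
    | zero =>
      apply degExact_zero_of_eq_bot (isDegOne_degPart _)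
      rw [eq_bot_iff]
      rintro _ ⟨f, hf, rfl⟩
      exact Ideal.Quotient.eq_zero_iff_mem.2 (mem_of_isWeightedHomogeneous hX (by omega) hf)
    | succ i => exact degExact_succ_of_torsion (X_smul_eq_zero hX) _ i s
  · intro 𝔞 h j h1 h2
    obtain ⟨s₁, h1⟩ := h1
    obtain ⟨s₂, h2⟩ := h2
    -- The shift by one is the twist of S/(𝔞 : x_j)(-1) in the exact sequence.
    refine ⟨max (s₁ + 1) s₂, fun i s hs => ?_⟩
    exact (isGradedSES_colon h j).degExact_middle (isDegOne_degPart _) (isDegOne_degPart _)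
      (isDegOne_degPart _) (h1 i _ (by omega)) (h2 i s (by omega))
  · intro 𝔞 h j hj h2
    obtain ⟨s₂, h2⟩ := h2
    refine ⟨s₂ - 1, fun i s hs => ?_⟩
    cases i with
    | zero =>
      exact degExact_zero_of_regular j (isDegOne_degPart _)
        ((injective_iff_map_eq_zero (LinearMap.lsmul (MvPolynomial (Fin n) K)
          (MvPolynomial (Fin n) K ⧸ 𝔞) (X j))).1 hj) s
    | succ i =>
      exact degExact_succ_of_regular j (isGradedSES_regular h j hj) (isDegOne_degPart _)
        (isDegOne_degPart _) (h2 i) s hs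

theorem ringKrullDim_sup_add_one_le {S : Type*} [CommRing S] {𝔞 : Ideal S} {b : S}
    (hb : Function.Injective (LinearMap.lsmul S (S ⧸ 𝔞) b)) :
    ringKrullDim (S ⧸ (𝔞 ⊔ Ideal.span {b})) + 1 ≤ ringKrullDim (S ⧸ 𝔞) := by
  have hr : Ideal.Quotient.mk 𝔞 b ∈ nonZeroDivisors (S ⧸ 𝔞) := by
    rw [mem_nonZeroDivisors_iff_right]
    intro m hm
    refine (injective_iff_map_eq_zero _).1 hb m ?_
    rw [mul_comm] at hm
    exact (Algebra.smul_def b m).trans hm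
  refine le_trans ?_ (ringKrullDim_quotient_succ_le_of_nonZeroDivisor hr)
  gcongr
  refine ringKrullDim_le_of_surjective (Ideal.Quotient.lift _
    (Ideal.Quotient.factor (le_sup_left : 𝔞 ≤ 𝔞 ⊔ Ideal.span {b})) ?_) ?_
  · intro a ha
    obtain ⟨c, rfl⟩ := Ideal.mem_span_singleton.1 ha
    rw [map_mul]
    have : Ideal.Quotient.factor (le_sup_left : 𝔞 ≤ 𝔞 ⊔ Ideal.span {b})
        (Ideal.Quotient.mk 𝔞 b) = 0 :=
      Ideal.Quotient.eq_zero_iff_mem.2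
        (Ideal.mem_sup_right (Ideal.mem_span_singleton_self b))
    rw [this, zero_mul]
  · intro m
    obtain ⟨f, rfl⟩ := Ideal.Quotient.mk_surjective m
    exact ⟨Ideal.Quotient.mk _ (Ideal.Quotient.mk 𝔞 f), rfl⟩

theorem ringKrullDim_quotient_le {S : Type*} [CommRing S] {𝔞 𝔟 : Ideal S} (h : 𝔞 ≤ 𝔟) :
    ringKrullDim (S ⧸ 𝔟) ≤ ringKrullDim (S ⧸ 𝔞) :=
  ringKrullDim_le_of_surjective (Ideal.Quotient.factor h) (Ideal.Quotient.factor_surjective h)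

/-- Grothendieck vanishing: `H^i_𝔪(S / 𝔞) = 0` for `i > dim S / 𝔞`. -/
theorem degExact_of_ringKrullDim_lt {𝔞 : Ideal (MvPolynomial (Fin n) K)} (h : IsHomog 𝔞) :
    ∀ i : ℕ, ringKrullDim (MvPolynomial (Fin n) K ⧸ 𝔞) < i →
      ∀ s, DegExact (X : Fin n → MvPolynomial (Fin n) K)
        (degPart K n (MvPolynomial (Fin n) K ⧸ 𝔞)) i s := by
  refine homogeneous_induction (P := fun 𝔞 => ∀ i : ℕ,
    ringKrullDim (MvPolynomial (Fin n) K ⧸ 𝔞) < i → ∀ s,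
    DegExact (X : Fin n → MvPolynomial (Fin n) K) (degPart K n (MvPolynomial (Fin n) K ⧸ 𝔞)) i s)
    ?_ ?_ ?_ 𝔞 h
  · intro 𝔞 h hX i hi s
    cases i with
    | zero =>
      -- The base case includes the unit ideal; a nonzero quotient has dimension at least 0, against
      -- the hypothesis.
      rcases subsingleton_or_nontrivial (MvPolynomial (Fin n) K ⧸ 𝔞) with hs | hs
      · exact degExact_of_subsingleton _ _ _
      · exact absurd hi (not_lt.2 (by exact_mod_cast ringKrullDim_nonneg_of_nontrivial))
    | succ i => exact degExact_succ_of_torsion (X_smul_eq_zero hX) _ i s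
  · intro 𝔞 h j h1 h2 i hi s
    refine (isGradedSES_colon h j).degExact_middle (isDegOne_degPart _) (isDegOne_degPart _)
      (isDegOne_degPart _) (h1 i (lt_of_le_of_lt (ringKrullDim_quotient_le fun f hf => ?_) hi) _)
      (h2 i (lt_of_le_of_lt (ringKrullDim_quotient_le le_sup_left) hi) s)
    exact Submodule.mem_colon_singleton.2 (𝔞.mul_mem_right _ hf)
  · intro 𝔞 h j hj h2 i hi s
    cases i with
    | zero =>
      exact degExact_zero_of_regular j (isDegOne_degPart _)
        ((injective_iff_map_eq_zero (LinearMap.lsmul (MvPolynomial (Fin n) K)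
          (MvPolynomial (Fin n) K ⧸ 𝔞) (X j))).1 hj) s
    | succ i =>
      -- A regular variable lowers the dimension by at least one, matching the drop of the
      -- cohomological index.
      have hlt : ringKrullDim (MvPolynomial (Fin n) K ⧸ (𝔞 ⊔ Ideal.span {X j})) < i := by
        have := (ringKrullDim_sup_add_one_le hj).trans_lt hi
        push_cast at this
        exact lt_of_add_lt_add_right this
      exact degExact_succ_of_regular (s₀ := s + 1) j (isGradedSES_regular h j hj)
        (isDegOne_degPart _) (isDegOne_degPart _) (fun t _ => h2 i hlt t) s (by omega)

/-! #### Nonvanishing -/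

section Trivial

variable {A : Type*} [CommRing A] {x : Fin n → A} {M : Type*} [AddCommGroup M] [Module A M]

/-- With every graded piece equal to M, the graded lemmas become ungraded ones. They can then be
applied to regular elements that are not homogeneous. -/
theorem isDegOne_top : IsDegOne x (fun _ => (⊤ : AddSubgroup M)) :=
  fun _ _ _ _ => AddSubgroup.mem_top _

theorem mem_cochainDeg_top {i : ℕ} {s : ℤ} (z : Cochain x M i) :
    z ∈ cochainDeg x (fun _ => (⊤ : AddSubgroup M)) i s := by
  rw [mem_cochainDeg]
  intro σ
  obtain ⟨m, k, e⟩ := exists_frac x (z σ)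
  rw [e]
  exact frac_mem_locDeg (AddSubgroup.mem_top _)

theorem mem_cobDeg_top {i : ℕ} {s : ℤ} {z : Cochain x M i} (hz : z ∈ cechB x M i) :
    z ∈ cobDeg x (fun _ => (⊤ : AddSubgroup M)) i s := by
  cases i with
  | zero => exact hz
  | succ i =>
    obtain ⟨y, rfl⟩ := hz
    exact ⟨y, mem_cochainDeg_top y, rfl⟩

theorem isGradedSES_top {𝔞 : Ideal A} {b : A}
    (hb : Function.Injective (LinearMap.lsmul A (A ⧸ 𝔞) b)) :
    IsGradedSES (fun _ => (⊤ : AddSubgroup (A ⧸ 𝔞))) (fun _ => (⊤ : AddSubgroup (A ⧸ 𝔞)))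
      (fun _ => (⊤ : AddSubgroup (A ⧸ (𝔞 ⊔ Ideal.span {b}))))
      (LinearMap.lsmul _ _ b) (projSup 𝔞 b) 0 where
  inj := hb
  map_f := fun _ _ _ => AddSubgroup.mem_top _
  map_g := fun _ _ _ => AddSubgroup.mem_top _
  lift := by
    intro t m _
    obtain ⟨f, rfl⟩ := Ideal.Quotient.mk_surjective m
    exact ⟨_, AddSubgroup.mem_top _, projSup_mk 𝔞 b f⟩
  exact := by
    intro t m _ h0
    obtain ⟨f, rfl⟩ := Ideal.Quotient.mk_surjective m
    rw [projSup_mk, Ideal.Quotient.eq_zero_iff_mem] at h0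
    obtain ⟨u, hu, v, hv, rfl⟩ := Submodule.mem_sup.1 h0
    obtain ⟨c, rfl⟩ := Ideal.mem_span_singleton.1 hv
    refine ⟨Ideal.Quotient.mk 𝔞 c, AddSubgroup.mem_top _, ?_⟩
    rw [map_add, Ideal.Quotient.eq_zero_iff_mem.2 hu, zero_add]
    rfl
  comp := by
    intro m
    obtain ⟨f, rfl⟩ := Ideal.Quotient.mk_surjective m
    exact mk_mul_sup 𝔞 b f

/-- Prime avoidance: if 𝔪 consists of zero divisors modulo 𝔞, its image lies in one of the finitely
many associated primes, which is the annihilator of some y. -/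
theorem exists_torsion_or_regular [IsNoetherianRing A] (𝔪 : Ideal A) (𝔞 : Ideal A) :
    (∃ y : A ⧸ 𝔞, y ≠ 0 ∧ ∀ f ∈ 𝔪, f • y = 0) ∨
      ∃ f ∈ 𝔪, Function.Injective (LinearMap.lsmul A (A ⧸ 𝔞) f) := by
  by_cases hne : ∃ f ∈ 𝔪, Function.Injective (LinearMap.lsmul A (A ⧸ 𝔞) f)
  · exact Or.inr hne
  left
  push Not at hne
  have hsub : ((𝔪.map (Ideal.Quotient.mk 𝔞) : Ideal (A ⧸ 𝔞)) : Set (A ⧸ 𝔞)) ⊆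
      ⋃ P ∈ associatedPrimes (A ⧸ 𝔞) (A ⧸ 𝔞), ((id P : Ideal (A ⧸ 𝔞)) : Set (A ⧸ 𝔞)) := by
    intro m hm
    obtain ⟨f, hf, rfl⟩ :=
      (Ideal.mem_map_iff_of_surjective _ Ideal.Quotient.mk_surjective).1 hm
    simp only [id]
    rw [biUnion_associatedPrimes_eq_compl_nonZeroDivisors]
    intro hnz
    refine hne f hf ?_
    rw [injective_iff_map_eq_zero]
    intro m hm
    refine (mem_nonZeroDivisors_iff_right.1 hnz) m ?_
    rw [mul_comm]
    exact (Algebra.smul_def f m).symm.trans hm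
  -- Every member of the family is prime, so the two exceptional ideals of prime avoidance are the
  -- dummies `⊤`.
  obtain ⟨P, hP, hle⟩ := (Ideal.subset_union_prime_finite (associatedPrimes.finite _ _) ⊤ ⊤
    (fun P hP _ _ => IsAssociatedPrime.isPrime hP)).1 hsub
  obtain ⟨hPp, y, hy⟩ := isAssociatedPrime_iff.1 (AssociatedPrimes.mem_iff.1 hP)
  refine ⟨y, ?_, fun f hf => ?_⟩
  · rintro rfl
    apply hPp.ne_top
    rw [hy]
    simp
  · have := hle (Ideal.mem_map_of_mem (Ideal.Quotient.mk 𝔞) hf)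
    change _ ∈ P at this
    rw [hy, Submodule.mem_colon_singleton, Submodule.mem_bot] at this
    exact (Algebra.smul_def f y).trans this

/-- An element killed by 𝔪 gives a nonzero class in H^0. Otherwise some f ∈ 𝔪 is regular, and total
vanishing for A/𝔞 passes to A/(𝔞 + (f)) by the long exact sequence, contradicting the induction
hypothesis. -/
theorem not_forall_degExact_top [IsNoetherianRing A] (𝔪 : Ideal A) (h𝔪 : 𝔪 ≠ ⊤)
    (hx : ∀ j, x j ∈ 𝔪) (𝔞 : Ideal A) (h : 𝔞 ≤ 𝔪) :
    ¬ ∀ i, DegExact x (fun _ => (⊤ : AddSubgroup (A ⧸ 𝔞))) i 0 := by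
  induction 𝔞 using IsNoetherian.induction with
  | _ 𝔞 ih =>
  intro H
  rcases exists_torsion_or_regular 𝔪 𝔞 with ⟨y, hy0, hy⟩ | ⟨f, hf, hinj⟩
  · have h0 := H 0 (fun σ => frac x σ.1 y 0) (mem_cochainDeg_top _) (by
      ext σ
      rw [cechD_apply, Pi.zero_apply]
      refine Finset.sum_eq_zero fun j _ => ?_
      rw [res_frac, pow_zero, one_smul, (frac_eq_zero x).2 ⟨1, ?_⟩, smul_zero]
      rw [pow_one]
      exact hy _ (𝔪.mem_of_dvd (Finset.dvd_prod_of_mem x j.2) (hx j)))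
    have h1 := congrFun (show _ = (0 : Cochain x (A ⧸ 𝔞) 0) from h0) ⟨∅, rfl⟩
    rw [Pi.zero_apply, frac_eq_zero] at h1
    obtain ⟨c, hc⟩ := h1
    rw [xProd, Finset.prod_empty, one_pow, one_smul] at hc
    exact hy0 hc
  · refine ih (𝔞 ⊔ Ideal.span {f}) (lt_of_le_of_ne le_sup_left fun e => ?_)
      (sup_le h ((Ideal.span_singleton_le_iff_mem _).2 hf)) fun i => ?_
    · have hf' : f ∈ 𝔞 := by
        rw [e]
        exact Ideal.mem_sup_right (Ideal.mem_span_singleton_self f)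
      have h1 : (1 : A ⧸ 𝔞) = 0 := by
        refine (injective_iff_map_eq_zero _).1 hinj 1 ?_
        exact (Algebra.smul_def f 1).trans (by
          rw [mul_one]
          exact Ideal.Quotient.eq_zero_iff_mem.2 hf')
      refine h𝔪 ((Ideal.eq_top_iff_one _).2 (h (Ideal.Quotient.eq_zero_iff_mem.1 h1)))
    · exact (isGradedSES_top hinj).degExact_right isDegOne_top isDegOne_top isDegOne_top
        (by rw [sub_zero]; exact H (i + 1)) (H i)

end Trivial

theorem degPart_independent {𝔞 : Ideal (MvPolynomial (Fin n) K)} (h : IsHomog 𝔞) (T : Finset ℤ)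
    (m : ℤ → MvPolynomial (Fin n) K ⧸ 𝔞) (r : ℤ) (hm : ∀ t, m t ∈ degPart K n _ (t + r))
    (hsum : ∑ t ∈ T, m t = 0) (t : ℤ) (ht : t ∈ T) : m t = 0 := by
  choose f hf hfm using fun t => mem_degPart.1 (hm t)
  have h1 : ∑ t ∈ T, f t ∈ 𝔞 := by
    rw [← Ideal.Quotient.eq_zero_iff_mem, map_sum, ← hsum]
    exact Finset.sum_congr rfl fun t _ => hfm t
  have h2 := h _ h1 (t + r)
  rw [map_sum, Finset.sum_eq_single t] at h2
  · rw [(hf t).weightedHomogeneousComponent_same] at h2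
    rw [← hfm t]
    exact Ideal.Quotient.eq_zero_iff_mem.2 h2
  · intro u _ hu
    exact (hf u).weightedHomogeneousComponent_ne _ (by omega)
  · exact fun h => absurd ht h

theorem locDeg_independent {𝔞 : Ideal (MvPolynomial (Fin n) K)} (h : IsHomog 𝔞)
    {σ : Finset (Fin n)} (T : Finset ℤ)
    (w : ℤ → Loc (X : Fin n → MvPolynomial (Fin n) K) (MvPolynomial (Fin n) K ⧸ 𝔞) σ)
    (hw : ∀ s, w s ∈ locDeg X (degPart K n (MvPolynomial (Fin n) K ⧸ 𝔞)) σ s)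
    (hsum : ∑ s ∈ T, w s = 0) (s : ℤ) (hs : s ∈ T) : w s = 0 := by
  have hD := isDegOne_degPart (K := K) (n := n) (MvPolynomial (Fin n) K ⧸ 𝔞)
  choose k m hm e using fun s => hD.mem_locDeg.1 (hw s)
  have hle (s) (hs : s ∈ T) : k s ≤ T.sup k := Finset.le_sup hs
  generalize T.sup k = k₀ at hle
  have e' (s) (hs : s ∈ T) : w s =
      frac X σ (xProd (X : Fin n → MvPolynomial (Fin n) K) σ ^ (k₀ - k s) • m s) k₀ := by
    rw [e, frac_expand X (m s) (k s) (k₀ - k s), Nat.add_sub_cancel' (hle s hs)]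
  rw [Finset.sum_congr rfl e', ← frac_sum, frac_eq_zero] at hsum
  obtain ⟨c, hc⟩ := hsum
  rw [Finset.smul_sum] at hc
  rw [e' s hs, frac_eq_zero]
  refine ⟨c, ?_⟩
  -- Outside `T` the exponent `k₀ - k s` may be truncated and the degree wrong, so the family is set
  -- to zero there.
  let m' (s : ℤ) : MvPolynomial (Fin n) K ⧸ 𝔞 :=
    if s ∈ T then xProd (X : Fin n → MvPolynomial (Fin n) K) σ ^ c •
      xProd (X : Fin n → MvPolynomial (Fin n) K) σ ^ (k₀ - k s) • m s else 0
  have h3 := degPart_independent h T m' ((k₀ + c) * σ.card) ?_ ?_ s hs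
  · simpa only [m', if_pos hs] using h3
  · intro t
    by_cases ht : t ∈ T
    · simp only [m', if_pos ht]
      convert hD.xProd_pow_smul_mem σ c (hD.xProd_pow_smul_mem σ (k₀ - k t) (hm t)) using 2
      have := hle t ht
      push_cast [Nat.cast_sub this]
      ring
    · simp only [m', if_neg ht]
      exact zero_mem _
  · rw [← hc]
    exact Finset.sum_congr rfl fun t ht => by simp only [m', if_pos ht]

theorem frac_mk_mem_iSup {𝔞 : Ideal (MvPolynomial (Fin n) K)} {i : ℕ}
    (σ : {σ : Finset (Fin n) // σ.card = i}) (k : ℕ) (f : MvPolynomial (Fin n) K) :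
    (Pi.single σ (frac X σ.1 (Ideal.Quotient.mk 𝔞 f) k) : Cochain _ _ i) ∈
      ⨆ s, cochainDeg (X : Fin n → MvPolynomial (Fin n) K)
        (degPart K n (MvPolynomial (Fin n) K ⧸ 𝔞)) i s := by
  induction f using MvPolynomial.induction_on' with
  | monomial d a =>
    refine AddSubgroup.mem_iSup_of_mem ((d.degree : ℤ) - k * σ.1.card) ?_
    rw [mem_cochainDeg]
    intro τ
    by_cases hτ : τ = σ
    · subst hτ
      rw [Pi.single_eq_same]
      refine frac_mem_locDeg ?_
      rw [sub_add_cancel]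
      refine mk_mem_degPart (isWeightedHomogeneous_monomial _ d a ?_)
      exact weight_one_int d
    · rw [Pi.single_eq_of_ne hτ]
      exact zero_mem _
  | add f g hf hg =>
    rw [map_add, frac_add, Pi.single_add]
    exact add_mem hf hg

theorem exists_sum_of_mem_iSup {G : Type*} [AddCommGroup G] {H : ℤ → AddSubgroup G} {z : G}
    (hz : z ∈ ⨆ s, H s) :
    ∃ c : ℤ →₀ G, (∀ s, c s ∈ H s) ∧ z = ∑ s ∈ c.support, c s := by
  refine AddSubgroup.iSup_induction H (C := fun z => ∃ c : ℤ →₀ G,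
      (∀ s, c s ∈ H s) ∧ z = ∑ s ∈ c.support, c s) hz ?_ ?_ ?_
  · intro s y hy
    refine ⟨Finsupp.single s y, fun t => ?_, ?_⟩
    · by_cases h : t = s
      · subst h
        simpa using hy
      · rw [Finsupp.single_eq_of_ne h]
        exact zero_mem _
    · exact (Finsupp.sum_single_index (h := fun _ y => y) rfl).symm
  · exact ⟨0, fun _ => zero_mem _, by simp⟩
  · rintro _ _ ⟨c, hc, rfl⟩ ⟨c', hc', rfl⟩
    refine ⟨c + c', fun s => add_mem (hc s) (hc' s), ?_⟩
    exact (Finsupp.sum_add_index' (h := fun _ y => y) (fun _ => rfl) (fun _ _ _ => rfl)).symm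

theorem exists_homogeneous_decomposition {𝔞 : Ideal (MvPolynomial (Fin n) K)} {i : ℕ}
    (z : Cochain (X : Fin n → MvPolynomial (Fin n) K) (MvPolynomial (Fin n) K ⧸ 𝔞) i) :
    ∃ c : ℤ →₀ Cochain (X : Fin n → MvPolynomial (Fin n) K) (MvPolynomial (Fin n) K ⧸ 𝔞) i,
      (∀ s, c s ∈ cochainDeg X (degPart K n _) i s) ∧ z = ∑ s ∈ c.support, c s := by
  apply exists_sum_of_mem_iSup
  rw [← Finset.univ_sum_single z]
  refine AddSubgroup.sum_mem _ fun σ _ => ?_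
  obtain ⟨m, k, e⟩ := exists_frac X (z σ)
  obtain ⟨f, rfl⟩ := Ideal.Quotient.mk_surjective m
  rw [e]
  exact frac_mk_mem_iSup σ k f

/-- The local cohomology of a nonzero graded quotient of `S` does not vanish. -/
theorem exists_localCohDeg_ne_bot {𝔞 : Ideal (MvPolynomial (Fin n) K)} (h : IsHomog 𝔞)
    (htop : 𝔞 ≠ ⊤) : ∃ (i : ℕ) (s : ℤ),
      localCohDeg (X : Fin n → MvPolynomial (Fin n) K)
        (degPart K n (MvPolynomial (Fin n) K ⧸ 𝔞)) i s ≠ ⊥ := by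
  by_contra! H
  refine not_forall_degExact_top (x := X) (RingHom.ker (constantCoeff : _ →+* K))
    (RingHom.ker_ne_top _) (fun j => by simp [RingHom.mem_ker]) 𝔞 ?_ ?_
  · intro f hf
    rw [RingHom.mem_ker]
    by_contra hc
    -- A nonzero constant term would be a component of f in 𝔞, hence a unit in 𝔞.
    refine htop (Ideal.eq_top_of_isUnit_mem 𝔞 (h f hf 0) ?_)
    have : component 0 f = C (constantCoeff f) := by
      ext d
      rw [coeff_component, coeff_C, constantCoeff_eq]
      by_cases hd : d = 0
      · simp [hd]
      · rw [if_neg, if_neg (Ne.symm hd)]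
        simpa [Finsupp.degree_eq_zero_iff] using hd
    rw [this]
    exact (isUnit_iff_ne_zero.2 hc).map C
  · intro i z _ hz
    -- By independence of the graded pieces each homogeneous component of a cocycle is a cocycle,
    -- hence a coboundary; so is their sum.
    obtain ⟨c, hc, rfl⟩ := exists_homogeneous_decomposition z
    refine mem_cobDeg_top (sum_mem fun s hs => ?_)
    refine localCohDeg_eq_bot.1 (H i s) (c s) (hc s) ?_
    ext σ
    rw [map_sum] at hz
    refine locDeg_independent h c.support (fun s => cechD X _ i (c s) σ)
      (fun s => mem_cochainDeg.1 ((isDegOne_degPart _).cechD_mem (hc s)) σ) ?_ s hs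
    simpa using congrFun hz σ

end Polynomial

/-! ### Local cohomology of a direct sum decomposition over the q-th power map -/

section Decomposition

variable {A : Type*} [CommRing A] {n : ℕ} {x : Fin n → A} {q : ℕ}

section

variable {M N : Type*} [AddCommGroup M] [Module A M] [AddCommGroup N] [Module A N]
  {𝓜 : ℤ → AddSubgroup M} {𝓛 : ℤ → AddSubgroup N}

theorem cochainMap_mem_cechB {Ψ : ∀ σ, Loc x M σ →+ Loc x N σ}
    (hΨ : ∀ {τ σ} (h : τ ⊆ σ) z, Ψ σ (res x M h z) = res x N h (Ψ τ z)) {i : ℕ}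
    {c : Cochain x M i} (hc : c ∈ cechB x M i) : cochainMap x Ψ i c ∈ cechB x N i := by
  cases i with
  | zero =>
    rw [show c = 0 from hc, map_zero]
    exact zero_mem _
  | succ i =>
    obtain ⟨y, rfl⟩ := hc
    exact ⟨_, cechD_cochainMap x hΨ y⟩

theorem locMap_mem_locDeg (h : IsDegOne x 𝓜) {φ : M →+ N}
    (hφ : ∀ (a : A) m, φ (a • m) = a ^ q • φ m) {a : ℤ}
    (hdeg : ∀ t, ∀ m ∈ 𝓜 t, φ m ∈ 𝓛 (q * t + a)) {σ : Finset (Fin n)} {t : ℤ} {z : Loc x M σ}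
    (hz : z ∈ locDeg x 𝓜 σ t) : locMap x q φ hφ σ z ∈ locDeg x 𝓛 σ (q * t + a) := by
  obtain ⟨k, m, hm, rfl⟩ := h.mem_locDeg.1 hz
  rw [locMap_frac]
  refine frac_mem_locDeg ?_
  convert hdeg _ _ hm using 2
  push_cast
  ring

variable (hq : 0 < q) {π : N →+ M} (hπ : ∀ (a : A) m, π (a ^ q • m) = a • π m)

theorem locDesc_mem_locDeg (h : IsDegOne x 𝓛) {a : ℤ}
    (hdeg : ∀ t, ∀ m ∈ 𝓛 (q * t + a), π m ∈ 𝓜 t) {σ : Finset (Fin n)} {t : ℤ} {z : Loc x N σ}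
    (hz : z ∈ locDeg x 𝓛 σ (q * t + a)) : locDesc x q hq π hπ σ z ∈ locDeg x 𝓜 σ t := by
  obtain ⟨k, m, hm, rfl⟩ := h.mem_locDeg.1 hz
  rw [locDesc_frac]
  refine frac_mem_locDeg (hdeg _ _ ?_)
  convert h.xProd_pow_smul_mem σ (k * (q - 1)) hm using 2
  push_cast [Nat.cast_sub hq]
  ring

/-- Passing from a fraction over x_σ^k to the argument of `π` changes the degree by qk|σ|, so the
residue class modulo q is kept. -/
theorem locDesc_eq_zero (h : IsDegOne x 𝓛) {a : ℤ}
    (hdeg : ∀ s, (¬∃ t, s = q * t + a) → ∀ m ∈ 𝓛 s, π m = 0) {σ : Finset (Fin n)} {s : ℤ}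
    (hs : ¬∃ t, s = q * t + a) {z : Loc x N σ}
    (hz : z ∈ locDeg x 𝓛 σ s) : locDesc x q hq π hπ σ z = 0 := by
  obtain ⟨k, m, hm, rfl⟩ := h.mem_locDeg.1 hz
  rw [locDesc_frac, hdeg _ _ _ (h.xProd_pow_smul_mem σ (k * (q - 1)) hm), frac_zero]
  rintro ⟨t, ht⟩
  refine hs ⟨t - k * σ.card, ?_⟩
  push_cast [Nat.cast_sub hq] at ht
  linear_combination ht

theorem locDesc_locMap {φ : M →+ N} (hφ : ∀ (a : A) m, φ (a • m) = a ^ q • φ m)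
    (hπφ : ∀ m, π (φ m) = m) (σ : Finset (Fin n)) (z : Loc x M σ) :
    locDesc x q hq π hπ σ (locMap x q φ hφ σ z) = z := by
  obtain ⟨m, k, rfl⟩ := exists_frac x z
  rw [locMap_frac, locDesc_frac, mul_assoc, mul_comm q, ← mul_assoc, pow_mul, hπ, hπφ]
  obtain ⟨r, rfl⟩ : ∃ r, q = r + 1 := ⟨q - 1, by omega⟩
  rw [frac_expand x m k (k * r), Nat.add_sub_cancel, mul_add, mul_one, add_comm k]

end

variable {ι : Type*} [Fintype ι] {M : ι → Type*} {N : Type*} [∀ l, AddCommGroup (M l)]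
  [∀ l, Module A (M l)] [AddCommGroup N] [Module A N] {𝓜 : ∀ l, ℤ → AddSubgroup (M l)}
  {𝓛 : ℤ → AddSubgroup N}

/-- If `F_* N`, the module `N` with scalars restricted along `a ↦ a ^ q`, is the direct sum of
the modules `M l` with shifted gradings, then the same holds for the local cohomology. -/
theorem localCohDeg_ne_bot_iff_of_decomposition (hq : 0 < q) (h𝓜 : ∀ l, IsDegOne x (𝓜 l))
    (h𝓛 : IsDegOne x 𝓛) (φ : ∀ l, M l →+ N) (π : ∀ l, N →+ M l) (deg : ι → ℤ)
    (hφ : ∀ l (a : A) m, φ l (a • m) = a ^ q • φ l m)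
    (hπ : ∀ l (a : A) m, π l (a ^ q • m) = a • π l m) (hπφ : ∀ l m, π l (φ l m) = m)
    (hsum : ∀ m, ∑ l, φ l (π l m) = m)
    (hφdeg : ∀ l t, ∀ m ∈ 𝓜 l t, φ l m ∈ 𝓛 (q * t + deg l))
    (hπdeg : ∀ l t, ∀ m ∈ 𝓛 (q * t + deg l), π l m ∈ 𝓜 l t)
    (hπzero : ∀ l s, (¬∃ t, s = q * t + deg l) → ∀ m ∈ 𝓛 s, π l m = 0) (i : ℕ) (s : ℤ) :
    localCohDeg x 𝓛 i s ≠ ⊥ ↔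
      ∃ l t, s = q * t + deg l ∧ localCohDeg x (𝓜 l) i t ≠ ⊥ := by
  have hsumLoc (σ : Finset (Fin n)) (z : Loc x N σ) :
      ∑ l, locMap x q (φ l) (hφ l) σ (locDesc x q hq (π l) (hπ l) σ z) = z := by
    obtain ⟨m, k, rfl⟩ := exists_frac x z
    simp only [locDesc_frac, locMap_frac]
    rw [← frac_sum, hsum, frac_expand x m k (k * (q - 1))]
    congr 1
    obtain ⟨r, rfl⟩ : ∃ r, q = r + 1 := ⟨q - 1, by omega⟩
    simp only [Nat.add_sub_cancel]
    ring
  constructor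
  · contrapose!
    intro H
    rw [localCohDeg_eq_bot]
    intro z hz hd
    -- Each summand of z is the lift of its descent, and lifting preserves coboundaries; it remains
    -- to treat the descents.
    have e : z = ∑ l, cochainMap x (locMap x q (φ l) (hφ l)) i
        (cochainMap x (locDesc x q hq (π l) (hπ l)) i z) := by
      ext σ
      rw [Finset.sum_apply]
      exact (hsumLoc σ.1 (z σ)).symm
    rw [e]
    refine sum_mem fun l _ => cochainMap_mem_cechB (fun h z => locMap_res x q _ _ h z) ?_
    by_cases hs : ∃ t, s = q * t + deg l
    · obtain ⟨t, rfl⟩ := hs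
      refine localCohDeg_eq_bot.1 (H l t rfl) _ (mem_cochainDeg.2 fun σ => ?_) ?_
      · exact locDesc_mem_locDeg hq (hπ l) h𝓛 (hπdeg l) (mem_cochainDeg.1 hz σ)
      · rw [cechD_cochainMap x (fun h z => locDesc_res x q hq _ _ h z), hd, map_zero]
    · have : cochainMap x (locDesc x q hq (π l) (hπ l)) i z = 0 := by
        ext σ
        exact locDesc_eq_zero hq (hπ l) h𝓛 (hπzero l) hs (mem_cochainDeg.1 hz σ)
      rw [this]
      exact zero_mem _
  · rintro ⟨l, t, rfl, H⟩ H'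
    refine H (localCohDeg_eq_bot.2 fun z hz hd => ?_)
    -- M_l is a retract of N, so a cocycle is a coboundary once its lift is one.
    have e : cochainMap x (locDesc x q hq (π l) (hπ l)) i
        (cochainMap x (locMap x q (φ l) (hφ l)) i z) = z := by
      ext σ
      exact locDesc_locMap hq (hπ l) (hφ l) (hπφ l) σ.1 (z σ)
    rw [← e]
    refine cochainMap_mem_cechB (fun h z => locDesc_res x q hq _ _ h z)
      (localCohDeg_eq_bot.1 H' _ (mem_cochainDeg.2 fun σ => ?_) ?_)
    · exact locMap_mem_locDeg (h𝓜 l) (hφ l) (hφdeg l) (mem_cochainDeg.1 hz σ)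
    · rw [cechD_cochainMap x (fun h z => locMap_res x q _ _ h z), hd, map_zero]

end Decomposition

/-! ### A basis of K over its q-th powers -/

section FrobeniusBasis

/-- The κ_l are the coordinate functions of a basis. The off-diagonal values κ_l(b_k) are not
recorded: the splitting needs only retractions and the total sum. -/
theorem exists_semilinear_basis {F L : Type*} [Field F] [Field L] {f : F →+* L} (hf : f.Finite) :
    ∃ (m : ℕ) (b : Fin m → L) (κ : Fin m → L →+ F), (∀ l a c, κ l (f a * c) = a * κ l c) ∧
      (∀ c, ∑ l, f (κ l c) * b l = c) ∧ ∀ l, κ l (b l) = 1 := by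
  let _ := f.toAlgebra
  have : Module.Finite F L := hf
  let B := Module.finBasis F L
  refine ⟨_, B, fun l => (B.coord l).toAddMonoidHom, fun l a c => ?_, fun c => ?_, fun l => ?_⟩
  · exact (B.coord l).map_smul a c
  · exact B.sum_repr c
  · exact (B.coord_apply l _).trans (by simp)

theorem finite_iterateFrobenius {K : Type*} [Field K] {p : ℕ} [Fact p.Prime] [CharP K p]
    (hK : (frobenius K p).Finite) (e : ℕ) : (iterateFrobenius K p e).Finite := by
  induction e with
  | zero => simpa using RingHom.Finite.id K
  | succ e ih =>
    rw [iterateFrobenius_add, iterateFrobenius_one]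
    exact ih.comp hK

end FrobeniusBasis

/-! ### The splitting of S over its q-th powers -/

section FrobeniusPolynomial

variable {K : Type*} [Field K] {n : ℕ} (q : ℕ) (κ : K →+ K) (α : Fin n →₀ ℕ)

/-- The exponents divided by `q`, rounded down. -/
def divExp (d : Fin n →₀ ℕ) : Fin n →₀ ℕ := d.mapRange (· / q) (Nat.zero_div q)

theorem divExp_add {q : ℕ} (hq : 0 < q) (γ d : Fin n →₀ ℕ) :
    divExp q (q • γ + d) = γ + divExp q d := by
  ext j
  simp [divExp, Nat.mul_add_div hq]

theorem divExp_eq_zero {q : ℕ} {α : Fin n →₀ ℕ} (hα : ∀ j, α j < q) : divExp q α = 0 := by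
  ext j
  simp [divExp, Nat.div_eq_of_lt (hα j)]

theorem divExp_spec {q : ℕ} (d : Fin n →₀ ℕ) (h : ∀ j, d j % q = α j) :
    d = α + q • divExp q d := by
  ext j
  simp [divExp, ← h j, Nat.mod_add_div]

/-- The additive map of `S = K[x_1, …, x_n]` that sends `c x ^ (α + q γ)` to `κ(c) x ^ γ`, and the
other monomials to zero. -/
def frobDesc : MvPolynomial (Fin n) K →+ MvPolynomial (Fin n) K :=
  (Finsupp.liftAddHom fun d => if d = α + q • divExp q d then
    (monomial (R := K) (divExp q d)).toAddMonoidHom.comp κ else 0).comp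
    AddMonoidAlgebra.coeffAddEquiv.toAddMonoidHom

theorem frobDesc_monomial (d : Fin n →₀ ℕ) (c : K) :
    frobDesc q κ α (monomial d c) =
      if d = α + q • divExp q d then monomial (divExp q d) (κ c) else 0 := by
  have : AddMonoidAlgebra.coeffAddEquiv (monomial d c) = Finsupp.single d c := rfl
  simp only [frobDesc, AddMonoidHom.comp_apply]
  change Finsupp.liftAddHom _ (AddMonoidAlgebra.coeffAddEquiv (monomial d c)) = _
  rw [this, Finsupp.liftAddHom_apply_single]
  split_ifs <;> rfl

variable {q κ α}

/-- In characteristic p both sides are additive in g and in f, so monomials suffice. -/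
theorem frobDesc_pow_mul {p e : ℕ} [Fact p.Prime] [CharP K p] (hq : q = p ^ e)
    (hκ : ∀ a c, κ (a ^ q * c) = a * κ c) (g f : MvPolynomial (Fin n) K) :
    frobDesc q κ α (g ^ q * f) = g * frobDesc q κ α f := by
  have hq0 : 0 < q := hq ▸ pow_pos (Fact.out (p := p.Prime)).pos e
  induction g using MvPolynomial.induction_on' with
  | monomial γ a =>
    induction f using MvPolynomial.induction_on' with
    | monomial d c =>
      rw [monomial_pow, monomial_mul, frobDesc_monomial, frobDesc_monomial, divExp_add hq0, hκ,
        smul_add, add_left_comm]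
      simp only [add_right_inj]
      split_ifs
      · rw [monomial_mul]
      · rw [mul_zero]
    | add f f' hf hf' => rw [mul_add, map_add, hf, hf', map_add, mul_add]
  | add g g' hg hg' =>
    rw [hq, add_pow_char_pow, ← hq, add_mul, map_add, hg, hg', add_mul]

theorem frobDesc_monomial_self {b : K} (hα : ∀ j, α j < q) :
    frobDesc q κ α (monomial α b) = C (κ b) := by
  rw [frobDesc_monomial, divExp_eq_zero hα, smul_zero, add_zero, if_pos rfl, C_apply]

variable (q α) in
/-- The additive map `g ↦ b x ^ α g ^ q` of `S = K[x_1, …, x_n]`, for `q` a power of the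
characteristic. -/
def frobLift (p e : ℕ) [Fact p.Prime] [CharP K p] (hq : q = p ^ e) (b : K) :
    MvPolynomial (Fin n) K →+ MvPolynomial (Fin n) K where
  toFun g := monomial α b * g ^ q
  map_zero' := by
    rw [zero_pow (hq ▸ pow_pos (Fact.out (p := p.Prime)).pos e).ne', mul_zero]
  map_add' g g' := by
    rw [hq, add_pow_char_pow, mul_add]

variable (q) in
/-- The exponent vector with entries `a j`. -/
def expVec (a : Fin n → Fin q) : Fin n →₀ ℕ := Finsupp.equivFunOnFinite.symm fun j => (a j : ℕ)

theorem expVec_lt (a : Fin n → Fin q) (j : Fin n) : expVec q a j < q := (a j).2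

/-- For a monomial x^d only the vector α of residues of d modulo q contributes; the sum over l then
expands the coefficient in the basis. -/
theorem sum_frobLift_frobDesc {p e : ℕ} [Fact p.Prime] [CharP K p] (hq : q = p ^ e) {m : ℕ}
    {b : Fin m → K} {κ : Fin m → K →+ K} (hsum : ∀ c, ∑ l, (κ l c) ^ q * b l = c)
    (f : MvPolynomial (Fin n) K) :
    ∑ l : Fin m × (Fin n → Fin q), frobLift q (expVec q l.2) p e hq (b l.1)
      (frobDesc q (κ l.1) (expVec q l.2) f) = f := by
  have hq0 : 0 < q := hq ▸ pow_pos (Fact.out (p := p.Prime)).pos e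
  induction f using MvPolynomial.induction_on' with
  | add f f' hf hf' =>
    simp only [map_add, Finset.sum_add_distrib, hf, hf']
  | monomial d c =>
    rw [Fintype.sum_prod_type]
    let a₀ : Fin n → Fin q := fun j => ⟨d j % q, Nat.mod_lt _ hq0⟩
    have hd : d = expVec q a₀ + q • divExp q d := divExp_spec (expVec q a₀) d fun j => rfl
    have h1 (l : Fin m) : ∑ a : Fin n → Fin q, frobLift q (expVec q a) p e hq (b l)
        (frobDesc q (κ l) (expVec q a) (monomial d c)) = monomial d ((κ l c) ^ q * b l) := by
      rw [Finset.sum_eq_single a₀]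
      · rw [frobDesc_monomial, if_pos hd]
        change monomial _ _ * _ = _
        rw [monomial_pow, monomial_mul, ← hd, mul_comm]
      · intro a _ ha
        rw [frobDesc_monomial, if_neg, map_zero]
        intro h
        apply ha
        ext j
        have h2 := DFunLike.congr_fun h j
        change (a j : ℕ) = d j % q
        rw [h2]
        change _ = ((a j : ℕ) + q * _) % q
        rw [Nat.add_mul_mod_self_left, Nat.mod_eq_of_lt (a j).2]
      · intro h
        exact absurd (Finset.mem_univ _) h
    rw [Finset.sum_congr rfl fun l _ => h1 l, ← map_sum, hsum]

theorem frobDesc_isWeightedHomogeneous {f : MvPolynomial (Fin n) K} {t : ℤ}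
    (hq : 0 < q) (hf : IsWeightedHomogeneous (fun _ : Fin n => (1 : ℤ)) f (q * t + α.degree)) :
    IsWeightedHomogeneous (fun _ : Fin n => (1 : ℤ)) (frobDesc q κ α f) t := by
  rw [← support_sum_monomial_coeff f, map_sum]
  refine IsWeightedHomogeneous.sum _ _ _ fun d hd => ?_
  rw [frobDesc_monomial]
  split_ifs with h
  · refine isWeightedHomogeneous_monomial _ _ _ ?_
    have h1 := hf (mem_support_iff.1 hd)
    rw [weight_one_int] at h1 ⊢
    rw [h, map_add, map_nsmul] at h1
    push_cast at h1
    have h2 : (q : ℤ) * (divExp q d).degree = q * t := by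
      simp only [smul_eq_mul, Nat.cast_mul] at h1
      linarith
    exact mul_left_cancel₀ (by exact_mod_cast hq.ne') h2
  · exact isWeightedHomogeneous_zero _ _ _

theorem frobDesc_eq_zero {f : MvPolynomial (Fin n) K} {s : ℤ}
    (hf : IsWeightedHomogeneous (fun _ : Fin n => (1 : ℤ)) f s)
    (hs : ¬∃ t : ℤ, s = q * t + α.degree) : frobDesc q κ α f = 0 := by
  rw [← support_sum_monomial_coeff f, map_sum]
  refine Finset.sum_eq_zero fun d hd => ?_
  rw [frobDesc_monomial, if_neg]
  intro h
  have h1 := hf (mem_support_iff.1 hd)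
  rw [weight_one_int, h, map_add, map_nsmul] at h1
  refine hs ⟨(divExp q d).degree, ?_⟩
  rw [← h1]
  simp only [smul_eq_mul]
  push_cast
  ring

theorem frobLift_isWeightedHomogeneous {p e : ℕ} [Fact p.Prime] [CharP K p] (hq : q = p ^ e) (b : K)
    {g : MvPolynomial (Fin n) K} {t : ℤ}
    (hg : IsWeightedHomogeneous (fun _ : Fin n => (1 : ℤ)) g t) :
    IsWeightedHomogeneous (fun _ : Fin n => (1 : ℤ)) (frobLift q α p e hq b g)
      (q * t + α.degree) := by
  have h1 := (isWeightedHomogeneous_monomial (fun _ : Fin n => (1 : ℤ)) α b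
    (weight_one_int α)).mul (hg.pow q)
  rwa [nsmul_eq_mul, add_comm] at h1

end FrobeniusPolynomial

/-! ### Colon ideals of I and compatibility of the splitting with J^[q] -/

section Ideals

variable {K : Type*} [Field K] {n : ℕ} {I : Ideal (MvPolynomial (Fin n) K)}

/-- The monomials in a colon ideal of a squarefree monomial ideal. -/
theorem IsSquarefreeMonomial.exists_mem_colon_iff (hI : IsSquarefreeMonomial I) :
    ∃ G : Set (Finset (Fin n)),
      I = Ideal.span ((fun N : Finset (Fin n) => ∏ j ∈ N, (X j : MvPolynomial (Fin n) K)) '' G) ∧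
      ∀ (α : Fin n →₀ ℕ) (f : MvPolynomial (Fin n) K), f ∈ I.colon {monomial α (1 : K)} ↔
        ∀ d ∈ f.support, ∃ N ∈ G, ∀ j ∈ N, d j + α j ≠ 0 := by
  obtain ⟨G, hG⟩ := hI
  let u (N : Finset (Fin n)) : Fin n →₀ ℕ := ∑ j ∈ N, Finsupp.single j 1
  have hu (N : Finset (Fin n)) (j : Fin n) : u N j = if j ∈ N then 1 else 0 := by
    simp [u, Finsupp.finsetSum_apply, Finsupp.single_apply]
  have hG' : I = Ideal.span ((fun d => monomial d (1 : K)) '' (u '' G)) := by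
    rw [hG, Set.image_image]
    congr 1
    refine Set.image_congr fun N _ => ?_
    simp only [u, X]
    exact (monomial_sum_one _ _).symm
  refine ⟨G, hG, fun α f => ?_⟩
  rw [Submodule.mem_colon_singleton, smul_eq_mul, hG', mem_ideal_span_monomial_image]
  -- The exponents of a generator are 0 or 1, so divisibility by it depends only on the support.
  have hle (N : Finset (Fin n)) (d : Fin n →₀ ℕ) : u N ≤ d ↔ ∀ j ∈ N, d j ≠ 0 := by
    rw [Finsupp.le_def]
    refine forall_congr' fun j => ?_
    rw [hu]
    split_ifs with h <;> simp [h, Nat.one_le_iff_ne_zero]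
  simp only [Set.exists_mem_image, hle]
  constructor
  · intro h d hd
    refine h (d + α) ?_
    rw [mem_support_iff, coeff_mul_monomial, mul_one]
    exact mem_support_iff.1 hd
  · intro h d hd
    rw [mem_support_iff, coeff_mul_monomial'] at hd
    split_ifs at hd with hα
    · rw [mul_one] at hd
      obtain ⟨N, hN, h1⟩ := h _ (mem_support_iff.2 hd)
      refine ⟨N, hN, fun j hj => ?_⟩
      have := h1 j hj
      rwa [← Finsupp.add_apply, tsub_add_cancel_of_le hα] at this
    · exact absurd rfl hd

theorem IsSquarefreeMonomial.isHomog_colon (hI : IsSquarefreeMonomial I) (α : Fin n →₀ ℕ) :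
    IsHomog (I.colon {monomial α (1 : K)}) := by
  obtain ⟨G, -, hG⟩ := hI.exists_mem_colon_iff
  intro f hf t
  rw [hG] at hf ⊢
  intro d hd
  refine hf d ?_
  rw [mem_support_iff, coeff_component] at hd
  rw [mem_support_iff]
  intro h
  simp [h] at hd

theorem IsSquarefreeMonomial.colon_congr (hI : IsSquarefreeMonomial I) {α β : Fin n →₀ ℕ}
    (h : ∀ j, α j = 0 ↔ β j = 0) :
    I.colon {monomial α (1 : K)} = I.colon {monomial β (1 : K)} := by
  obtain ⟨G, -, hG⟩ := hI.exists_mem_colon_iff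
  ext f
  rw [hG, hG]
  refine forall₂_congr fun d _ => exists_congr fun N => and_congr_right fun _ =>
    forall₂_congr fun j _ => ?_
  have := h j
  simp only [ne_eq, Nat.add_eq_zero_iff, this]

theorem isHomog_preimage {J : Ideal (MvPolynomial (Fin n) K ⧸ I)} (hJ : IsHomogeneousIdeal J) :
    IsHomog (preimage J) := by
  intro f hf t
  by_cases ht : 0 ≤ t
  · have : component t f = homogeneousComponent t.toNat f := by
      ext d
      rw [coeff_component, coeff_homogeneousComponent]
      exact if_congr (by omega) rfl rfl
    rw [this]
    exact hJ f hf _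
  · have : component t f = 0 := by
      ext d
      rw [coeff_component, if_neg (by omega), coeff_zero]
    rw [this]
    exact zero_mem _

theorem IsHomog.sup {𝔞 𝔟 : Ideal (MvPolynomial (Fin n) K)} (h : IsHomog 𝔞) (h' : IsHomog 𝔟) :
    IsHomog (𝔞 ⊔ 𝔟) := by
  intro f hf t
  obtain ⟨u, hu, v, hv, rfl⟩ := Submodule.mem_sup.1 hf
  rw [map_add]
  exact Submodule.add_mem_sup (h u hu t) (h' v hv t)

theorem bracketPow_eq_map (J : Ideal (MvPolynomial (Fin n) K ⧸ I)) (q : ℕ) :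
    bracketPow J q =
      (Ideal.span ((fun g => g ^ q) '' (preimage J : Set (MvPolynomial (Fin n) K)))).map
        (Ideal.Quotient.mk I) := by
  rw [Ideal.map_span, bracketPow]
  congr 1
  ext r
  constructor
  · rintro ⟨m, hm, rfl⟩
    obtain ⟨g, rfl⟩ := Ideal.Quotient.mk_surjective m
    exact ⟨_, ⟨g, hm, rfl⟩, map_pow _ _ _⟩
  · rintro ⟨_, ⟨g, hg, rfl⟩, rfl⟩
    exact ⟨_, hg, (map_pow _ _ _).symm⟩

theorem mk_mem_bracketPow_iff (J : Ideal (MvPolynomial (Fin n) K ⧸ I)) (q : ℕ)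
    (f : MvPolynomial (Fin n) K) : Ideal.Quotient.mk I f ∈ bracketPow J q ↔
      f ∈ Ideal.span ((fun g => g ^ q) '' (preimage J : Set (MvPolynomial (Fin n) K))) ⊔ I := by
  rw [bracketPow_eq_map, ← Ideal.mem_comap,
    Ideal.comap_map_of_surjective _ Ideal.Quotient.mk_surjective, ← RingHom.ker_eq_comap_bot,
    Ideal.mk_ker]

variable {q p e : ℕ} [Fact p.Prime] [CharP K p]

/-- If u x^α ∈ I, then b x^α u^q = b u^(q-1) (u x^α) ∈ I; elements of J have their q-th powers in
J^[q]. -/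
theorem mk_frobLift_mem_bracketPow (hq : q = p ^ e) (J : Ideal (MvPolynomial (Fin n) K ⧸ I))
    {α : Fin n →₀ ℕ} {b : K} {g : MvPolynomial (Fin n) K}
    (hg : g ∈ I.colon {monomial α (1 : K)} ⊔ preimage J) :
    Ideal.Quotient.mk I (frobLift q α p e hq b g) ∈ bracketPow J q := by
  have hq0 : 0 < q := hq ▸ pow_pos (Fact.out (p := p.Prime)).pos e
  obtain ⟨u, hu, v, hv, rfl⟩ := Submodule.mem_sup.1 hg
  rw [mk_mem_bracketPow_iff, map_add, add_comm]
  refine Submodule.add_mem_sup ?_ ?_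
  · exact Ideal.mul_mem_left _ _ (Ideal.subset_span ⟨v, hv, rfl⟩)
  · obtain ⟨r, rfl⟩ : ∃ r, q = r + 1 := ⟨q - 1, by omega⟩
    rw [Submodule.mem_colon_singleton, smul_eq_mul] at hu
    change monomial α b * u ^ (r + 1) ∈ I
    have : monomial α b * u ^ (r + 1) = C b * u ^ r * (u * monomial α 1) := by
      rw [← mul_one b, ← C_mul_monomial, mul_one]
      ring
    rw [this]
    exact I.mul_mem_left _ hu

theorem frobDesc_mem (hI : IsSquarefreeMonomial I) (hq : q = p ^ e)
    (J : Ideal (MvPolynomial (Fin n) K ⧸ I)) {κ : K →+ K} (hκ : ∀ a c, κ (a ^ q * c) = a * κ c)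
    {α : Fin n →₀ ℕ} {f : MvPolynomial (Fin n) K}
    (hf : Ideal.Quotient.mk I f ∈ bracketPow J q) :
    frobDesc q κ α f ∈ I.colon {monomial α (1 : K)} ⊔ preimage J := by
  have hq0 : 0 < q := hq ▸ pow_pos (Fact.out (p := p.Prime)).pos e
  -- `frobDesc` is not S-linear, so it is tested on all multiples of the generators.
  have key {s : Set (MvPolynomial (Fin n) K)} {𝔟 : Ideal (MvPolynomial (Fin n) K)}
      (hs : ∀ u ∈ s, ∀ h, frobDesc q κ α (h * u) ∈ 𝔟) {u : MvPolynomial (Fin n) K}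
      (hu : u ∈ Ideal.span s) : frobDesc q κ α u ∈ 𝔟 := by
    suffices ∀ h, frobDesc q κ α (h * u) ∈ 𝔟 by simpa using this 1
    induction hu using Submodule.span_induction with
    | mem u hu => exact hs u hu
    | zero => simp
    | add u v _ _ hu hv =>
      intro h
      rw [mul_add, map_add]
      exact add_mem (hu h) (hv h)
    | smul a u _ hu =>
      intro h
      rw [smul_eq_mul, ← mul_assoc]
      exact hu _
  rw [mk_mem_bracketPow_iff] at hf
  obtain ⟨u, hu, v, hv, rfl⟩ := Submodule.mem_sup.1 hf
  rw [map_add, add_comm]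
  refine Submodule.add_mem_sup ?_ ?_
  · obtain ⟨G, hG, hG'⟩ := hI.exists_mem_colon_iff
    rw [hG] at hv
    refine key ?_ hv
    rintro _ ⟨N, hN, rfl⟩ h
    dsimp only
    have hX : (∏ j ∈ N, (X j : MvPolynomial (Fin n) K)) =
        monomial (∑ j ∈ N, Finsupp.single j 1) 1 := by
      simp only [X]
      exact (monomial_sum_one _ _).symm
    rw [hX]
    induction h using MvPolynomial.induction_on' with
    | add h h' ih ih' =>
      rw [add_mul, map_add]
      exact add_mem ih ih'
    | monomial d c =>
      rw [monomial_mul, frobDesc_monomial]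
      split_ifs with hd
      · rw [hG']
        intro d' hd'
        obtain rfl := Finset.mem_singleton.1 (support_monomial_subset hd')
        -- For j ∈ N the exponent of x_j in the product is positive, so α_j and the quotient
        -- exponent at j cannot both vanish.
        refine ⟨N, hN, fun j hj h0 => ?_⟩
        have h1 := DFunLike.congr_fun hd j
        rw [Nat.add_eq_zero_iff] at h0
        simp only [Finsupp.add_apply, Finsupp.smul_apply, h0.1, h0.2,
          Finsupp.finsetSum_apply, Finsupp.single_apply] at h1
        simp [hj] at h1
      · exact zero_mem _
  · refine key ?_ hu
    rintro _ ⟨g, hg, rfl⟩ h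
    dsimp only
    rw [mul_comm, frobDesc_pow_mul hq hκ]
    exact Ideal.mul_mem_right _ _ hg

end Ideals

/-! ### The splitting of R/J^[q] and of its local cohomology -/

section Main

variable {K : Type*} [Field K] {n : ℕ} {I : Ideal (MvPolynomial (Fin n) K)}

/-- The splitting maps are not S-linear, so they are passed to the quotients as additive maps. -/
theorem exists_lift_of_surjective {S B G : Type*} [AddCommGroup S] [AddCommGroup B]
    [AddCommGroup G] {ρ : S →+ B} (hρ : Function.Surjective ρ) (φ : S →+ G)
    (h : ∀ f, ρ f = 0 → φ f = 0) : ∃ ψ : B →+ G, ∀ f, ψ (ρ f) = φ f :=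
  ⟨AddMonoidHom.liftOfSurjective ρ hρ ⟨φ, h⟩,
    AddMonoidHom.liftOfRightInverse_comp_apply ρ _ (Function.rightInverse_surjInv hρ) ⟨φ, h⟩⟩

theorem algebraMap_bracket_eq_zero {J : Ideal (MvPolynomial (Fin n) K ⧸ I)} {q : ℕ}
    {f : MvPolynomial (Fin n) K} :
    algebraMap (MvPolynomial (Fin n) K) ((MvPolynomial (Fin n) K ⧸ I) ⧸ bracketPow J q) f = 0 ↔
      Ideal.Quotient.mk I f ∈ bracketPow J q :=
  Ideal.Quotient.eq_zero_iff_mem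

theorem algebraMap_bracket_surjective (J : Ideal (MvPolynomial (Fin n) K ⧸ I)) (q : ℕ) :
    Function.Surjective (algebraMap (MvPolynomial (Fin n) K)
      ((MvPolynomial (Fin n) K ⧸ I) ⧸ bracketPow J q)) :=
  Ideal.Quotient.mk_surjective.comp Ideal.Quotient.mk_surjective

/-- The local cohomology of `R / J^{[q]}` in terms of that of the rings
`S / ((I : x ^ α) + J)`. -/
theorem localCohDeg_bracketPow_ne_bot_iff {p : ℕ} [Fact p.Prime] [CharP K p]
    (hK : (frobenius K p).Finite) (hI : IsSquarefreeMonomial I)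
    (J : Ideal (MvPolynomial (Fin n) K ⧸ I)) (e i : ℕ) (s : ℤ) :
    localCohDeg (X : Fin n → MvPolynomial (Fin n) K)
        (degPart K n ((MvPolynomial (Fin n) K ⧸ I) ⧸ bracketPow J (p ^ e))) i s ≠ ⊥ ↔
      ∃ (α : Fin n →₀ ℕ) (t : ℤ), (∀ j, α j < p ^ e) ∧ s = (p ^ e : ℕ) * t + α.degree ∧
        localCohDeg (X : Fin n → MvPolynomial (Fin n) K)
          (degPart K n (ColonQuot J α)) i t ≠ ⊥ := by
  obtain ⟨m, b, κ, hκ, hsum, hκb⟩ := exists_semilinear_basis (finite_iterateFrobenius hK e)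
  simp only [iterateFrobenius_def] at hκ hsum
  generalize hq : p ^ e = q at *
  have hq0 : 0 < q := hq ▸ pow_pos (Fact.out (p := p.Prime)).pos e
  let A := MvPolynomial (Fin n) K
  let N := (MvPolynomial (Fin n) K ⧸ I) ⧸ bracketPow J q
  let ρN : A →+ N := (algebraMap A N).toAddMonoidHom
  have hρN : Function.Surjective ρN := algebraMap_bracket_surjective J q
  let ρ (a : Fin n → Fin q) : A →+ ColonQuot J (expVec q a) :=
    (algebraMap A (ColonQuot J (expVec q a))).toAddMonoidHom
  have hρ (a) : Function.Surjective (ρ a) := Ideal.Quotient.mk_surjective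
  have hφex (l : Fin m × (Fin n → Fin q)) : ∃ φ : ColonQuot J (expVec q l.2) →+ N,
      ∀ f, φ (ρ l.2 f) = ρN (frobLift q (expVec q l.2) p e hq.symm (b l.1) f) :=
    exists_lift_of_surjective (hρ l.2) (ρN.comp (frobLift q (expVec q l.2) p e hq.symm (b l.1)))
      fun f hf => algebraMap_bracket_eq_zero.2 (mk_frobLift_mem_bracketPow hq.symm J
        (Ideal.Quotient.eq_zero_iff_mem.1 hf))
  have hπex (l : Fin m × (Fin n → Fin q)) : ∃ π : N →+ ColonQuot J (expVec q l.2),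
      ∀ f, π (ρN f) = ρ l.2 (frobDesc q (κ l.1) (expVec q l.2) f) :=
    exists_lift_of_surjective hρN ((ρ l.2).comp (frobDesc q (κ l.1) (expVec q l.2)))
      fun f hf => Ideal.Quotient.eq_zero_iff_mem.2
        (frobDesc_mem hI hq.symm J (hκ l.1) (algebraMap_bracket_eq_zero.1 hf))
  choose φ hφ using hφex
  choose π hπ using hπex
  have hsmulN (a f : A) : a • ρN f = ρN (a * f) :=
    (Algebra.smul_def a (ρN f)).trans (map_mul (algebraMap A N) a f).symm
  have hsmul (l) (a f : A) : a • ρ l f = ρ l (a * f) := rfl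
  rw [localCohDeg_ne_bot_iff_of_decomposition (q := q)
    (𝓜 := fun l : Fin m × (Fin n → Fin q) => degPart K n (ColonQuot J (expVec q l.2))) hq0
    (fun l => isDegOne_degPart _) (isDegOne_degPart _) φ π
    (fun l => ((expVec q l.2).degree : ℤ))]
  · constructor
    · rintro ⟨l, t, rfl, h⟩
      exact ⟨expVec q l.2, t, expVec_lt l.2, rfl, h⟩
    · rintro ⟨α, t, hα, rfl, h⟩
      have hm : m ≠ 0 := by
        rintro rfl
        simpa using hsum 1
      have hαe : α = expVec q (fun j => ⟨α j, hα j⟩) := by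
        ext j
        rfl
      refine ⟨(⟨0, Nat.pos_of_ne_zero hm⟩, fun j => ⟨α j, hα j⟩), t, ?_, ?_⟩
      · rw [← hαe]
      · rw [← hαe]
        exact h
  · intro l a m
    obtain ⟨f, rfl⟩ := hρ l.2 m
    rw [hsmul, hφ, hφ, hsmulN]
    congr 1
    change _ * (a * f) ^ q = a ^ q * (_ * f ^ q)
    ring
  · intro l a m
    obtain ⟨f, rfl⟩ := hρN m
    rw [hsmulN, hπ, hπ, hsmul, frobDesc_pow_mul hq.symm (hκ l.1)]
  · intro l m
    obtain ⟨f, rfl⟩ := hρ l.2 m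
    rw [hφ, hπ]
    congr 1
    change frobDesc q (κ l.1) _ (_ * f ^ q) = f
    rw [mul_comm, frobDesc_pow_mul hq.symm (hκ l.1), frobDesc_monomial_self (expVec_lt l.2), hκb,
      C_1, mul_one]
  · intro m
    obtain ⟨f, rfl⟩ := hρN m
    simp only [hπ, hφ]
    rw [← map_sum, sum_frobLift_frobDesc hq.symm hsum]
  · rintro l t _ ⟨f, hf, rfl⟩
    exact ⟨_, frobLift_isWeightedHomogeneous hq.symm (b l.1) hf, (hφ l f).symm⟩
  · rintro l t _ ⟨f, hf, rfl⟩
    exact ⟨_, frobDesc_isWeightedHomogeneous hq0 hf, (hπ l f).symm⟩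
  · rintro l s hs _ ⟨f, hf, rfl⟩
    refine (hπ l f).trans ?_
    rw [frobDesc_eq_zero hf hs, map_zero]

end Main

/-! ### Integer bounds for a-invariants, exponent vectors, and the limit criterion -/

section Invariants

variable {K : Type*} [Field K] {n : ℕ} {B : Type*} [CommRing B]
  [Algebra (MvPolynomial (Fin n) K) B]

theorem localCohDeg_eq_bot_of_lt {A : Type*} [CommRing A] {x : Fin n → A} {M : Type*}
    [AddCommGroup M] [Module A M] (𝓜 : ℤ → AddSubgroup M) {i : ℕ} (hi : n < i) (s : ℤ) :
    localCohDeg x 𝓜 i s = ⊥ := by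
  rw [localCohDeg_eq_bot]
  intro z _ _
  have : z = 0 := by
    ext σ
    have h1 := Finset.card_le_univ σ.1
    rw [σ.2, Fintype.card_fin] at h1
    omega
  rw [this]
  exact zero_mem _

/-- Reduces bounds in `EReal` to integers; the value -∞ is the supremum of an empty family and needs
no separate case. -/
theorem aInv_add_le {i c : ℕ} {L : ℤ}
    (h : ∀ s, localCohDeg (X : Fin n → MvPolynomial (Fin n) K) (degPart K n B) i s ≠ ⊥ →
      s + c ≤ L) : aInv K n B i + ((c : ℝ) : EReal) ≤ ((L : ℝ) : EReal) := by
  have h1 : aInv K n B i ≤ ((L - c : ℝ) : EReal) := by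
    refine iSup₂_le fun s hs => EReal.coe_le_coe_iff.2 ?_
    have : (s + c : ℝ) ≤ L := by exact_mod_cast h s hs
    linarith
  refine (add_le_add h1 le_rfl).trans ?_
  rw [← EReal.coe_add, sub_add_cancel]

theorem le_aInv_add {i c : ℕ} {L s : ℤ}
    (hs : localCohDeg (X : Fin n → MvPolynomial (Fin n) K) (degPart K n B) i s ≠ ⊥)
    (h : L = s + c) : ((L : ℝ) : EReal) ≤ aInv K n B i + ((c : ℝ) : EReal) := by
  have h1 : ((s : ℝ) : EReal) ≤ aInv K n B i := le_iSup₂_of_le s hs le_rfl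
  refine le_trans ?_ (add_le_add h1 le_rfl)
  rw [← EReal.coe_add, h]
  push_cast
  exact le_rfl

theorem reg_eq_of_isGreatest {r : ℤ} (h : IsGreatest {w : ℤ | ∃ (i : ℕ) (s : ℤ),
    localCohDeg (X : Fin n → MvPolynomial (Fin n) K) (degPart K n B) i s ≠ ⊥ ∧ w = s + i} r) :
    reg K n B = ((r : ℝ) : EReal) := by
  apply le_antisymm
  · exact iSup_le fun i => aInv_add_le fun s hs => h.2 ⟨i, s, hs, rfl⟩
  · obtain ⟨i, s, hs, e⟩ := h.1
    exact le_iSup_of_le i (le_aInv_add hs e)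

theorem exists_isGreatest_int {s : Set ℤ} (hs : s.Nonempty) {b : ℤ} (hb : ∀ w ∈ s, w ≤ b) :
    ∃ r, IsGreatest s r :=
  ⟨sSup s, Int.csSup_mem hs ⟨b, hb⟩, fun _ hw => le_csSup ⟨b, hb⟩ hw⟩

theorem finite_zeroOneVectors (n : ℕ) : (zeroOneVectors n).Finite := by
  refine (Set.finite_Iic (Finsupp.equivFunOnFinite.symm fun _ : Fin n => 1)).subset ?_
  intro α hα j
  exact hα j

theorem degree_le_of_mem_zeroOneVectors {α : Fin n →₀ ℕ} (hα : α ∈ zeroOneVectors n) :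
    α.degree ≤ n := by
  rw [Finsupp.degree_eq_sum]
  exact (Finset.sum_le_sum fun j _ => hα j).trans (by simp)

/-- The indicator vector of the support. -/
def indVec (α : Fin n →₀ ℕ) : Fin n →₀ ℕ := α.mapRange (min · 1) (by simp)

theorem indVec_mem (α : Fin n →₀ ℕ) : indVec α ∈ zeroOneVectors n := fun j => by simp [indVec]

theorem indVec_eq_zero_iff (α : Fin n →₀ ℕ) (j : Fin n) : α j = 0 ↔ indVec α j = 0 := by
  simp [indVec]

theorem degree_le_mul_degree_indVec {q : ℕ} {α : Fin n →₀ ℕ} (hα : ∀ j, α j < q) :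
    α.degree ≤ (q - 1) * (indVec α).degree := by
  rw [Finsupp.degree_eq_sum, Finsupp.degree_eq_sum, Finset.mul_sum]
  refine Finset.sum_le_sum fun j _ => ?_
  have := hα j
  simp only [indVec, Finsupp.mapRange_apply]
  rcases Nat.eq_zero_or_pos (α j) with h | h
  · simp [h]
  · rw [min_eq_right h, mul_one]
    omega

theorem tendsto_div_pow_of_abs_sub_le {r : ℕ → ℤ} {L : ℤ} {C p : ℕ} (hp : 1 < p)
    (h : ∀ e, 1 ≤ e → |r e - (p ^ e : ℕ) * L| ≤ C) :
    Tendsto (fun e : ℕ => (r e : ℝ) / (p : ℝ) ^ e) atTop (𝓝 (L : ℝ)) := by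
  rw [← tendsto_sub_nhds_zero_iff]
  have hp1 : (1 : ℝ) < p := by exact_mod_cast hp
  refine squeeze_zero_norm' (a := fun e : ℕ => (C : ℝ) / (p : ℝ) ^ e) ?_
    (tendsto_const_nhds.div_atTop (tendsto_pow_atTop_atTop_of_one_lt hp1))
  filter_upwards [eventually_ge_atTop 1] with e he
  have hpe : (0 : ℝ) < (p : ℝ) ^ e := by positivity
  have h1 : |(r e : ℝ) - (p : ℝ) ^ e * L| ≤ C := by exact_mod_cast h e he
  rw [Real.norm_eq_abs, div_sub' hpe.ne', abs_div, abs_of_pos hpe]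
  gcongr

end Invariants

end SRRegularity

end

/-! ### The asymptotic regularity -/

theorem theorem6 {K : Type*} [Field K] (p : ℕ) [Fact p.Prime] [CharP K p]
    (hK : (frobenius K p).Finite) (n : ℕ)
    (I : Ideal (MvPolynomial (Fin n) K)) (hI : SRRegularity.IsSquarefreeMonomial I)
    (J : Ideal (MvPolynomial (Fin n) K ⧸ I)) (hJ : SRRegularity.IsHomogeneousIdeal J)
    (hJtop : J ≠ ⊤) :
    ∃ (r : ℕ → ℤ) (L : ℤ),
      (∀ e : ℕ, SRRegularity.reg K n
        ((MvPolynomial (Fin n) K ⧸ I) ⧸ SRRegularity.bracketPow J (p ^ e)) =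
          ((r e : ℝ) : EReal)) ∧
      IsGreatest {b : EReal | ∃ (i : ℕ) (α : Fin n →₀ ℕ),
          (i : WithBot ℕ∞) ≤ SRRegularity.maxDim J ∧ α ∈ SRRegularity.zeroOneVectors n ∧
          b = SRRegularity.aInv K n (SRRegularity.ColonQuot J α) i +
            ((α.degree : ℝ) : EReal)}
        ((L : ℝ) : EReal) ∧
      Tendsto (fun e : ℕ => (r e : ℝ) / (p : ℝ) ^ e) atTop (𝓝 (L : ℝ)) := by
  open SRRegularity in
  have hp : 1 < p := (Fact.out (p := p.Prime)).one_lt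
  have hhom (α : Fin n →₀ ℕ) : IsHomog (I.colon {monomial α (1 : K)} ⊔ preimage J) :=
    (hI.isHomog_colon α).sup (isHomog_preimage hJ)
  let V (i : ℕ) (α : Fin n →₀ ℕ) : Set ℤ := {t | localCohDeg
    (X : Fin n → MvPolynomial (Fin n) K) (degPart K n (ColonQuot J α)) i t ≠ ⊥}
  have hVcongr {α β : Fin n →₀ ℕ} (h : ∀ j, α j = 0 ↔ β j = 0) (i : ℕ) : V i α = V i β :=
    congrArg (fun 𝔞 : Ideal (MvPolynomial (Fin n) K) => {t | localCohDeg
      (X : Fin n → MvPolynomial (Fin n) K)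
      (degPart K n (MvPolynomial (Fin n) K ⧸ (𝔞 ⊔ preimage J))) i t ≠ ⊥}) (hI.colon_congr h)
  have hVn {i α t} (h : t ∈ V i α) : i ≤ n := by
    by_contra hi
    exact h (localCohDeg_eq_bot_of_lt _ (by omega) t)
  have hVdim {i α t} (hα : α ∈ zeroOneVectors n) (h : t ∈ V i α) :
      (i : WithBot ℕ∞) ≤ maxDim J := by
    by_contra hi
    refine h (degExact_of_ringKrullDim_lt (hhom α) i (lt_of_le_of_lt ?_ (not_le.1 hi))
      t).localCohDeg_eq_bot
    exact le_iSup₂_of_le (f := fun α _ => ringKrullDim (ColonQuot J α)) α hα le_rfl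
  obtain ⟨T, hT⟩ : ∃ T : ℤ, ∀ α ∈ zeroOneVectors n, ∀ i, ∀ t ∈ V i α, t ≤ T := by
    choose s₀ hs₀ using fun α => exists_degExact (hhom α)
    obtain ⟨T, hT⟩ := ((finite_zeroOneVectors n).image s₀).bddAbove
    refine ⟨T, fun α hα i t ht => ?_⟩
    by_contra hlt
    have := hT (Set.mem_image_of_mem s₀ hα)
    exact ht (hs₀ α i t (by omega)).localCohDeg_eq_bot
  have h0mem : (0 : Fin n →₀ ℕ) ∈ zeroOneVectors n := fun j => by simp
  -- For α = 0 the colon ideal is I ⊆ J, so the quotient is S/J, which is nonzero.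
  obtain ⟨i₀, t₀, h₀⟩ : ∃ i t, t ∈ V i 0 := by
    refine exists_localCohDeg_ne_bot (hhom 0) fun h => hJtop ?_
    have hle : I.colon {monomial (0 : Fin n →₀ ℕ) (1 : K)} ≤ preimage J := by
      intro f hf
      rw [Submodule.mem_colon_singleton, ← C_apply, C_1, smul_eq_mul, mul_one] at hf
      rw [Ideal.mem_comap, Ideal.Quotient.eq_zero_iff_mem.2 hf]
      exact zero_mem _
    rw [sup_eq_right.2 hle] at h
    exact (Ideal.comap_eq_top_iff).1 h
  let D : Set ℤ := {w | ∃ (i : ℕ) (α : Fin n →₀ ℕ) (t : ℤ), α ∈ zeroOneVectors n ∧ t ∈ V i α ∧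
    w = t + α.degree}
  obtain ⟨L, hL⟩ : ∃ L, IsGreatest D L := by
    refine exists_isGreatest_int ⟨_, i₀, 0, t₀, h0mem, h₀, rfl⟩ (b := T + n) ?_
    rintro _ ⟨i, α, t, hα, ht, rfl⟩
    have := hT α hα i t ht
    have := degree_le_of_mem_zeroOneVectors hα
    omega
  let W (e : ℕ) : Set ℤ := {w | ∃ (i : ℕ) (s : ℤ), localCohDeg
    (X : Fin n → MvPolynomial (Fin n) K)
    (degPart K n ((MvPolynomial (Fin n) K ⧸ I) ⧸ bracketPow J (p ^ e))) i s ≠ ⊥ ∧ w = s + i}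
  have hWmem (e w) : w ∈ W e ↔ ∃ (i : ℕ) (α : Fin n →₀ ℕ) (t : ℤ), (∀ j, α j < p ^ e) ∧
      t ∈ V i α ∧ w = (p ^ e : ℕ) * t + α.degree + i := by
    constructor
    · rintro ⟨i, s, h, rfl⟩
      obtain ⟨α, t, hα, rfl, ht⟩ := (localCohDeg_bracketPow_ne_bot_iff hK hI J e i s).1 h
      exact ⟨i, α, t, hα, ht, rfl⟩
    · rintro ⟨i, α, t, hα, ht, rfl⟩
      exact ⟨i, _, (localCohDeg_bracketPow_ne_bot_iff hK hI J e i _).2 ⟨α, t, hα, rfl, ht⟩, rfl⟩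
  -- If β is the support of α, then qt + |α| + i ≤ q(t + |β|) + i ≤ qL + n.
  have hub (e w) (hw : w ∈ W e) : w ≤ (p ^ e : ℕ) * L + n := by
    obtain ⟨i, α, t, hα, ht, rfl⟩ := (hWmem e w).1 hw
    have h1 : t + (indVec α).degree ≤ L :=
      hL.2 ⟨i, _, t, indVec_mem α, (hVcongr (indVec_eq_zero_iff α) i) ▸ ht, rfl⟩
    have h2 := degree_le_mul_degree_indVec hα
    have h3 := hVn ht
    have hq : 0 < p ^ e := by positivity
    generalize p ^ e = q at *
    obtain ⟨r, rfl⟩ : ∃ r, q = r + 1 := ⟨q - 1, by omega⟩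
    simp only [Nat.add_sub_cancel] at h2
    have h2' : (α.degree : ℤ) ≤ r * (indVec α).degree := by exact_mod_cast h2
    have h4 := mul_le_mul_of_nonneg_left h1 (by positivity : (0 : ℤ) ≤ (r + 1 : ℕ))
    have h5 : (0 : ℤ) ≤ (indVec α).degree := by positivity
    push_cast at h4 ⊢
    have h3' : (i : ℤ) ≤ n := by exact_mod_cast h3
    linarith
  -- The vector α = 0 is admissible for every e, including e = 0, so the set is nonempty.
  have hW (e) : ∃ r, IsGreatest (W e) r :=
    exists_isGreatest_int ⟨_, (hWmem e _).2 ⟨i₀, 0, t₀, fun _ => by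
      rw [Finsupp.zero_apply]; positivity, h₀, rfl⟩⟩ (hub e)
  choose r hr using hW
  refine ⟨r, L, fun e => reg_eq_of_isGreatest (hr e), ⟨?_, ?_⟩, ?_⟩
  · obtain ⟨i, α, t, hα, ht, e⟩ := hL.1
    refine ⟨i, α, hVdim hα ht, hα, le_antisymm (le_aInv_add ht e) (aInv_add_le fun s hs => ?_)⟩
    exact hL.2 ⟨i, α, s, hα, hs, rfl⟩
  · rintro _ ⟨i, α, -, hα, rfl⟩
    exact aInv_add_le fun s hs => hL.2 ⟨i, α, s, hα, hs, rfl⟩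
  · refine tendsto_div_pow_of_abs_sub_le (C := n) hp fun e he => ?_
    rw [abs_le]
    have h1 := hub e (r e) (hr e).1
    suffices (p ^ e : ℕ) * L - n ≤ r e by constructor <;> linarith
    obtain ⟨i, α, t, hα, ht, hLe⟩ := hL.1
    have hq : 1 < p ^ e := Nat.one_lt_pow (by omega) hp
    -- The largest admissible vector with the support of α; e ≥ 1 makes q - 1 nonzero and so keeps
    -- the support. Its value is qL - |α| + i ≥ qL - n.
    have hmem : ((p ^ e : ℕ) : ℤ) * t + ((p ^ e - 1) • α).degree + i ∈ W e := by
      refine (hWmem e _).2 ⟨i, (p ^ e - 1) • α, t, fun j => ?_, ?_, rfl⟩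
      · have h2 := Nat.mul_le_mul_left (p ^ e - 1) (hα j)
        rw [Finsupp.smul_apply, smul_eq_mul]
        omega
      · refine (hVcongr (fun j => ?_) i) ▸ ht
        simp only [Finsupp.smul_apply, smul_eq_mul, Nat.mul_eq_zero]
        omega
    have h2 := (hr e).2 hmem
    have h3 : (α.degree : ℤ) ≤ n := by exact_mod_cast degree_le_of_mem_zeroOneVectors hα
    rw [map_nsmul, smul_eq_mul] at h2
    push_cast [Nat.cast_sub hq.le] at h2 ⊢
    rw [hLe]
    have h4 : (0 : ℤ) ≤ i := by positivity
    nlinarith
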